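/- **Fractional Cheeger inequality.** For an open set $\Omega\subset\mathbb{R}^2$ let $r_\Omega=\sup\{\rho>0:\exists\,x\in\Omega,\ B_\rho(x)\subset\Omega\}$ be its inradius. For $s\in(0,1)$ and $p\in\{1,2\}$ let $$[u]_{W^{s,p}(\mathbb{R}^2)}=\Big(\iint_{\mathbb{R}^2\times\mathbb{R}^2}\frac{|u(x)-u(y)|^p}{|x-y|^{2+sp}}\,dx\,dy\Big)^{1/p},$$ let $\widetilde W^{s,2}_0(\Omega)$ be the closure of $C^\infty_0(\Omega)$ in $W^{s,2}(\mathbb{R}^2)=\{u\in L^2(\mathbb{R}^2):[u]_{W^{s,2}(\mathbb{R}^2)}<+\infty\}$ with the norm $\|u\|_{L^2(\mathbb{R}^2)}+[u]_{W^{s,2}(\mathbb{R}^2)}$, and let $$\lambda_1^s(\Omega)=\inf_{u\in\widetilde W^{s,2}_0(\Omega)\setminus\{0\}}\frac{[u]^2_{W^{s,2}(\mathbb{R}^2)}}{\|u\|^2_{L^2(\Omega)}}.$$ Let $P(E)$ be the De Giorgi perimeter of a measurable set $E\subset\mathbb{R}^2$, let $P_s(E)=[1_E]_{W^{s,1}(\mathbb{R}^2)}$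 be its $s$-perimeter, and let $$h_1(\Omega)=\inf_E\frac{P(E)}{|E|},\qquad h_s(\Omega)=\inf_E\frac{P_s(E)}{|E|},$$ where both infima are over the bounded measurable sets $E\subset\Omega$ with $|E|>0$. There are constants $\mathcal{C}_s>0$ ($1/2<s<1$), depending only on $s$, such that the limits $$\lim_{s\searrow 1/2}\frac{\mathcal{C}_s}{s-\frac12}\qquad\text{and}\qquad \lim_{s\nearrow 1}\,(1-s)\,\mathcal{C}_s$$ exist and are positive and finite, and such that for every $1/2<s<1$ and every open simply connected (in particular non-empty and connected) set $\Omega\subset\mathbb{R}^2$ with $r_\Omega<+\infty$ one has the fractional Makai–Hayman inequality $$\lambda_1^s(\Omega)\ge\frac{\mathcal{C}_s}{r_\Omega^{2s}}$$ and, with the same constant $\mathcal{C}_s$, $$\lambda_1^s(\Omega)\ge\mathcal{C}_s\Big(\frac{h_1(\Omega)}{2}\Big)^{2s}\qquad\text{and}\qquad \lambda_1^s(\Omega)\ge\mathcal{C}_s\Big(\frac{\pi}{P_s(B_1)}\,h_s(\Omega)\Big)^{2},$$ where $B_1$ is the unit disk. -/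

import Mathlib

open MeasureTheory Set Filter Topology
open scoped ENNReal ContDiff

noncomputable section

/-- The Euclidean space `ℝ^N`, with the Euclidean norm and Lebesgue measure. -/
abbrev RN (N : ℕ) : Type := EuclideanSpace ℝ (Fin N)

/-- The inradius `sup {ρ > 0 : ∃ x ∈ Ω, B_ρ(x) ⊆ Ω}`, as an extended nonnegative number. -/
def inradius {N : ℕ} (Ω : Set (RN N)) : ℝ≥0∞ :=
  ⨆ (ρ : ℝ) (_ : 0 < ρ ∧ ∃ x ∈ Ω, Metric.ball x ρ ⊆ Ω), ENNReal.ofReal ρ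

/-- The Gagliardo-Slobodeckii seminorm
`[u]_{W^{s,p}(ℝ^N)} = (∬ |u(x) - u(y)|^p / |x - y|^(N + s p) dx dy)^(1/p)`,
with value `∞` allowed. -/
def gagliardoSeminorm {N : ℕ} (s p : ℝ) (u : RN N → ℝ) : ℝ≥0∞ :=
  (∫⁻ x, ∫⁻ y, ‖u x - u y‖ₑ ^ p / ‖x - y‖ₑ ^ ((N : ℝ) + s * p)) ^ (1 / p)

/-- The norm `‖u‖_{L²(ℝ^N)} + [u]_{W^{s,2}(ℝ^N)}` of the fractional Sobolev space. -/
def fracSobolevNorm {N : ℕ} (s : ℝ) (u : RN N → ℝ) : ℝ≥0∞ :=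
  eLpNorm u 2 volume + gagliardoSeminorm s 2 u

/-- `u` (a representative of a class of functions) belongs to `W^{s,2}(ℝ^N)`. -/
def MemFracSobolev {N : ℕ} (s : ℝ) (u : RN N → ℝ) : Prop :=
  MemLp u 2 volume ∧ gagliardoSeminorm s 2 u < ⊤

/-- `φ ∈ C_0^∞(Ω)`: smooth on `ℝ^N`, with compact support contained in `Ω`. -/
def IsTestFunction {N : ℕ} (Ω : Set (RN N)) (φ : RN N → ℝ) : Prop :=
  ContDiff ℝ ∞ φ ∧ HasCompactSupport φ ∧ tsupport φ ⊆ Ω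

/-- `u` belongs to the closure of `C_0^∞(Ω)` in `W^{s,2}(ℝ^N)`. -/
def MemFracSobolevZero {N : ℕ} (s : ℝ) (Ω : Set (RN N)) (u : RN N → ℝ) : Prop :=
  MemFracSobolev s u ∧
    ∀ ε : ℝ≥0∞, 0 < ε → ∃ φ, IsTestFunction Ω φ ∧ fracSobolevNorm s (u - φ) < ε

/-- `λ₁^s(Ω)`: the infimum of `[u]²_{W^{s,2}(ℝ^N)} / ‖u‖²_{L²(Ω)}` over the nonzero elements
(that is, not almost everywhere zero) of the closure of `C_0^∞(Ω)` in `W^{s,2}(ℝ^N)`. -/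
def fracEigenvalue {N : ℕ} (s : ℝ) (Ω : Set (RN N)) : ℝ≥0∞ :=
  ⨅ (u : RN N → ℝ) (_ : MemFracSobolevZero s Ω u ∧ ¬ u =ᵐ[volume] 0),
    gagliardoSeminorm s 2 u ^ 2 / eLpNorm u 2 (volume.restrict Ω) ^ 2

/-- The divergence `∑ i, ∂φ_i/∂x_i` of a vector field. -/
def vecDivergence {N : ℕ} (φ : RN N → RN N) (x : RN N) : ℝ :=
  ∑ i : Fin N, (fderiv ℝ φ x (EuclideanSpace.single i 1)) i

/-- The perimeter in the sense of De Giorgi: the supremum of `∫_E div φ` over the vector fields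
`φ ∈ C_c^1(ℝ^N; ℝ^N)` with `|φ| ≤ 1` (the choice `φ = 0` shows that it is not negative). -/
def deGiorgiPerimeter {N : ℕ} (E : Set (RN N)) : ℝ≥0∞ :=
  ⨆ (φ : RN N → RN N) (_ : ContDiff ℝ 1 φ ∧ HasCompactSupport φ ∧ ∀ x, ‖φ x‖ ≤ 1),
    ENNReal.ofReal (∫ x in E, vecDivergence φ x)

/-- The `s`-perimeter `[1_E]_{W^{s,1}(ℝ^N)}`. -/
def fracPerimeter {N : ℕ} (s : ℝ) (E : Set (RN N)) : ℝ≥0∞ :=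
  gagliardoSeminorm s 1 (E.indicator fun _ => (1 : ℝ))

/-- The infimum of `Per(E) / |E|` over the bounded measurable `E ⊆ Ω` with `|E| > 0`. -/
def cheegerInf {N : ℕ} (Per : Set (RN N) → ℝ≥0∞) (Ω : Set (RN N)) : ℝ≥0∞ :=
  ⨅ (E : Set (RN N))
    (_ : E ⊆ Ω ∧ Bornology.IsBounded E ∧ MeasurableSet E ∧ 0 < volume E), Per E / volume E

/-- The Cheeger constant `h₁(Ω)`. -/
def cheegerConstant {N : ℕ} (Ω : Set (RN N)) : ℝ≥0∞ :=
  cheegerInf deGiorgiPerimeter Ω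

/-- The `s`-Cheeger constant `h_s(Ω)`. -/
def fracCheegerConstant {N : ℕ} (s : ℝ) (Ω : Set (RN N)) : ℝ≥0∞ :=
  cheegerInf (fracPerimeter s) Ω

end

/-!
The constant is `C s = (2s - 1) / (A (1 - s))` with a large absolute `A`, so everything reduces to
the lower bound `λ₁^s(Ω) ≥ c (2s - 1) / (1 - s) · r_Ω^(-2s)` with an absolute `c`
(`ofReal_le_fracEigenvalue`), together with upper bounds for `h₁` and `h_s` in terms of the
inradius.

Topology enters once: if `a ∉ Ω`, then no circle around `a` lies in `Ω`, since a branch of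
`log (z - a)` exists on `Ω` (`exists_circle_notMem_of_isSimplyConnected`). Hence a test function `u`
vanishes somewhere on every circle around `a`. For a function on the circle with a zero, Parseval's
identity and the Cauchy-Schwarz inequality applied to the Fourier series at the zero bound the
`L²` norm by the one-dimensional fractional seminorm, with the sharp factor `(1 - s) / (2s - 1)`
(`lintegral_circle_enorm_sq_le`). The one-dimensional seminorms of the circles of radius
`ρ ∈ (2R, 8R)` are integrated in `ρ` and compared with the planar seminorm: the increment of `u`
between two points of a circle at angular distance `h` is averaged over detours through points at
distance of order `R h`, and Tonelli's theorem rebuilds the planar kernel without any loss as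
`s → 1/2` or `s → 1` (`lintegral_enorm_sq_increment_le`, `lintegral_average_le`). This is a Poincaré
inequality on the annulus (`setLIntegral_annulus_enorm_sq_le`).

With `R = r_Ω`, every disc of radius `2R` contains a point outside `Ω`, so for each centre `c` the
disc `B_R(c)` lies in such an annulus, which lies in `B_{15R}(c)`. Integrating over `c` gives the
global inequality for continuous functions vanishing off `Ω`
(`eLpNorm_sq_le_gagliardoSeminorm_sq`), and density extends it to the closure of the test functions
(`le_fracEigenvalue`).

Finally `Ω` contains a disc of radius `R / 2`. A square in that disc and the divergence theorem
bound `h₁(Ω)` by `8 / R` (`cheegerConstant_le_of_ball_subset`), and the disc itself, by the scaling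
of `P_s`, bounds `h_s(Ω)` (`fracCheegerConstant_normalized_le_of_ball_subset`). A factor `16` in `A`
absorbs these comparisons.
-/

/-! ### Circles around a point missed by a simply connected set -/

/-- A planar simply connected open set that misses `a` contains no circle centred at `a`: otherwise
a continuous branch of `log (z - a)` on the set would return to its initial value after one turn,
although its imaginary part grows by `2π`. -/
theorem exists_circle_notMem_of_isSimplyConnected {U : Set ℂ} (hU : IsOpen U)
    (hU' : IsSimplyConnected U) {a : ℂ} (ha : a ∉ U) (ρ : ℝ) :
    ∃ θ : ℝ, a + ρ * Complex.exp (θ * Complex.I) ∉ U := by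
  by_contra! hcirc
  obtain ⟨g, hgc, hg⟩ := Complex.exists_continuousOn_eqOn_exp_comp hU' hU
    (g := fun z => z - a) (by fun_prop) (by
      rintro ⟨z, hz, hza⟩
      exact ha (by rwa [← sub_eq_zero.1 hza]))
  set γ : ℝ → ℂ := fun θ => a + ρ * Complex.exp (θ * Complex.I) with hγ
  have hγc : Continuous γ := by fun_prop
  set φ : ℝ → ℂ := fun θ => g (γ θ) - θ * Complex.I with hφ
  have hφc : Continuous φ :=
    (hgc.comp_continuous hγc hcirc).sub (by fun_prop)
  have hexp : ∀ θ, Complex.exp (φ θ) = ρ := by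
    intro θ
    have h1 : Complex.exp (g (γ θ)) = γ θ - a := hg (hcirc θ)
    rw [hφ, Complex.exp_sub, h1, hγ, add_sub_cancel_left]
    field_simp
  have hper : (φ (2 * Real.pi)).im = (φ 0).im - 2 * Real.pi := by
    have : γ (2 * Real.pi) = γ 0 := by simp [hγ]
    simp [hφ, this]
  obtain ⟨θ, -, hθ⟩ : (φ 0).im - Real.pi ∈ (fun θ => (φ θ).im) '' Icc 0 (2 * Real.pi) := by
    apply intermediate_value_Icc' Real.two_pi_pos.le (by fun_prop)
    simp only [hper]
    constructor <;> linarith [Real.pi_pos]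
  obtain ⟨n, hn⟩ := Complex.exp_eq_exp_iff_exists_int.1 ((hexp θ).trans (hexp 0).symm)
  have him := congrArg Complex.im hn
  simp only at hθ
  rw [hθ] at him
  simp at him
  have : (2 * n + 1 : ℝ) = 0 := by
    have := Real.pi_pos
    nlinarith
  have h2 : (2 * n + 1 : ℤ) = 0 := by exact_mod_cast this
  omega

/-! ### A fractional Poincaré inequality on the circle -/

instance fact_zero_lt_two_mul_pi : Fact (0 < 2 * Real.pi) := ⟨Real.two_pi_pos⟩

/-- The Cauchy-Schwarz inequality for series in `[0, ∞]`. -/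
theorem ENNReal.sq_tsum_mul_le {ι : Type*} (x y : ι → ℝ≥0∞) :
    (∑' i, x i * y i) ^ 2 ≤ (∑' i, x i ^ 2) * ∑' i, y i ^ 2 := by
  let _ : MeasurableSpace ι := ⊤
  have h := ENNReal.lintegral_mul_le_Lp_mul_Lq (Measure.count : Measure ι)
    Real.HolderConjugate.two_two (f := x) (g := y) measurable_from_top.aemeasurable
    measurable_from_top.aemeasurable
  simp only [Pi.mul_apply, lintegral_count] at h
  calc (∑' i, x i * y i) ^ 2
      ≤ ((∑' i, x i ^ (2 : ℝ)) ^ (1 / 2 : ℝ) * (∑' i, y i ^ (2 : ℝ)) ^ (1 / 2 : ℝ)) ^ 2 := by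
        gcongr
    _ = _ := by
        simp only [mul_pow, ← ENNReal.rpow_natCast, ← ENNReal.rpow_mul]
        norm_num

theorem sum_range_succ_rpow_neg_le {p : ℝ} (hp : 1 < p) (N : ℕ) :
    ∑ n ∈ Finset.range (N + 1), ((n : ℝ) + 1) ^ (-p) ≤
      p / (p - 1) - ((N : ℝ) + 1) ^ (1 - p) / (p - 1) := by
  have hp' : 0 < p - 1 := by linarith
  induction N with
  | zero =>
    simp
    field_simp
    linarith
  | succ N ih =>
    rw [Finset.sum_range_succ]
    push_cast
    set M : ℝ := (N : ℝ) + 1 with hM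
    have hM0 : 0 < M := by positivity
    -- the telescoping bound `(p - 1) (M + 1)^(-p) ≤ M^(1 - p) - (M + 1)^(1 - p)`
    have key : (M + 1) ^ (-p) * (p - 1) ≤ M ^ (1 - p) - (M + 1) ^ (1 - p) := by
      have hsplit : M ^ (1 - p) = (M + 1) ^ (1 - p) * (M / (M + 1)) ^ (1 - p) := by
        rw [← Real.mul_rpow (by positivity) (by positivity)]
        congr 1
        field_simp
      have hone : (M + 1) ^ (1 - p) = (M + 1) ^ (-p) * (M + 1) := by
        rw [← Real.rpow_add_one (by positivity)]
        congr 1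
        ring
      have hlog : Real.log (M / (M + 1)) ≤ -(1 / (M + 1)) := by
        refine (Real.log_le_sub_one_of_pos (by positivity)).trans (le_of_eq ?_)
        field_simp
        ring
      have hexp : 1 + (p - 1) / (M + 1) ≤ (M / (M + 1)) ^ (1 - p) := by
        rw [Real.rpow_def_of_pos (by positivity)]
        refine le_trans ?_ (Real.add_one_le_exp _)
        have := mul_le_mul_of_nonneg_left hlog hp'.le
        have h2 : (p - 1) * -(1 / (M + 1)) = - ((p - 1) / (M + 1)) := by ring
        nlinarith
      have hpos : 0 < (M + 1) ^ (1 - p) := by positivity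
      calc (M + 1) ^ (-p) * (p - 1)
          = (M + 1) ^ (1 - p) * (1 + (p - 1) / (M + 1)) - (M + 1) ^ (1 - p) := by
            rw [hone]
            field_simp
            ring
        _ ≤ _ := by
            rw [hsplit]
            gcongr
    have : (M + 1) ^ (-p) ≤ M ^ (1 - p) / (p - 1) - (M + 1) ^ (1 - p) / (p - 1) := by
      rw [← sub_div, le_div_iff₀ hp']
      exact key
    linarith

/-- The sum over the nonzero integers `k` of `|k|^(-p)` is at most `4 / (p - 1)`. -/
theorem tsum_int_rpow_neg_le {p : ℝ} (hp : 1 < p) (hp2 : p ≤ 2) :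
    ∑' k : ℤ, (if k = 0 then 0 else ENNReal.ofReal (|(k : ℝ)| ^ (-p))) ≤
      ENNReal.ofReal (4 / (p - 1)) := by
  have hp' : 0 < p - 1 := by linarith
  have hnat : ∑' n : ℕ, ENNReal.ofReal (((n : ℝ) + 1) ^ (-p)) ≤ ENNReal.ofReal (2 / (p - 1)) := by
    refine ENNReal.tsum_le_of_sum_range_le fun N => ?_
    rw [← ENNReal.ofReal_sum_of_nonneg (fun _ _ => by positivity)]
    refine ENNReal.ofReal_le_ofReal ?_
    refine (Finset.sum_le_sum_of_subset_of_nonneg (Finset.range_mono (Nat.le_succ N))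
      (fun _ _ _ => by positivity)).trans ((sum_range_succ_rpow_neg_le hp N).trans ?_)
    have : 0 ≤ ((N : ℝ) + 1) ^ (1 - p) / (p - 1) := by positivity
    have : p / (p - 1) ≤ 2 / (p - 1) := by gcongr
    linarith
  rw [tsum_of_nat_of_neg_add_one ENNReal.summable ENNReal.summable,
    tsum_eq_zero_add' ENNReal.summable]
  have h1 : ∀ n : ℕ, (if ((n + 1 : ℕ) : ℤ) = 0 then (0 : ℝ≥0∞) else
      ENNReal.ofReal (|(((n + 1 : ℕ) : ℤ) : ℝ)| ^ (-p))) =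
      ENNReal.ofReal (((n : ℝ) + 1) ^ (-p)) := by
    intro n
    rw [if_neg (by positivity)]
    push_cast
    rw [abs_of_nonneg (by positivity)]
  have h2 : ∀ n : ℕ, (if -((n : ℤ) + 1) = 0 then (0 : ℝ≥0∞) else
      ENNReal.ofReal (|((-((n : ℤ) + 1) : ℤ) : ℝ)| ^ (-p))) =
      ENNReal.ofReal (((n : ℝ) + 1) ^ (-p)) := by
    intro n
    rw [if_neg (by omega)]
    push_cast
    rw [abs_neg, abs_of_nonneg (by positivity)]
  simp only [h1, h2, Nat.cast_zero, if_true, zero_add]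
  refine (add_le_add hnat hnat).trans ?_
  rw [← ENNReal.ofReal_add (by positivity) (by positivity)]
  refine ENNReal.ofReal_le_ofReal (le_of_eq ?_)
  ring

section FourierCircle

open AddCircle

variable {T : ℝ} [hT : Fact (0 < T)]

theorem fourierCoeff_comp_add_right (f : AddCircle T → ℂ) (h : AddCircle T) (n : ℤ) :
    fourierCoeff (fun x => f (x + h)) n = fourier n h * fourierCoeff f n := by
  have := integral_add_right_eq_self (μ := (haarAddCircle : Measure (AddCircle T)))
    (fun t => fourier n h * (fourier (-n) t • f t)) h
  rw [fourierCoeff, fourierCoeff, ← integral_const_mul, ← this]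
  refine integral_congr_ae (.of_forall fun t => ?_)
  have h1 : (fourier n h * fourier (-n) h : ℂ) = 1 := by
    rw [← fourier_add]
    simp
  have h2 : (fourier (-n) (t + h) : ℂ) = fourier (-n) t * fourier (-n) h := by
    simp only [fourier_apply, smul_add, toCircle_add, Circle.coe_mul]
  simp only [smul_eq_mul, h2]
  linear_combination (-(fourier (-n) t * f (t + h))) * h1

/-- Parseval's identity with values in `[0, ∞]`. -/
theorem tsum_enorm_sq_fourierCoeff (f : C(AddCircle T, ℂ)) :
    ∑' n, ‖fourierCoeff f n‖ₑ ^ 2 = ∫⁻ t, ‖f t‖ₑ ^ 2 ∂haarAddCircle := by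
  have h := hasSum_sq_fourierCoeff (ContinuousMap.toLp (E := ℂ) 2 haarAddCircle ℂ f)
  simp only [fourierCoeff_toLp] at h
  have hae : ∫ t, ‖(ContinuousMap.toLp (E := ℂ) 2 haarAddCircle ℂ f) t‖ ^ 2 ∂haarAddCircle =
      ∫ t, ‖f t‖ ^ 2 ∂haarAddCircle := by
    refine integral_congr_ae ?_
    filter_upwards [ContinuousMap.coeFn_toLp (p := 2) (𝕜 := ℂ) haarAddCircle f] with t ht
    rw [ht]
  rw [hae] at h
  have hE : ∀ z : ℂ, ‖z‖ₑ ^ 2 = ENNReal.ofReal (‖z‖ ^ 2) := fun z => by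
    rw [ENNReal.ofReal_pow (norm_nonneg _), ofReal_norm]
  simp only [hE]
  rw [← ENNReal.ofReal_tsum_of_nonneg (fun _ => by positivity) h.summable, h.tsum_eq,
    ofReal_integral_eq_lintegral_ofReal _ (.of_forall fun _ => by positivity)]
  exact Continuous.integrable_of_hasCompactSupport (by fun_prop)
    (HasCompactSupport.of_compactSpace _)

theorem tsum_enorm_sq_mul_fourier_sub_one (f : C(AddCircle T, ℂ)) (h : AddCircle T) :
    ∑' n, ‖fourier n h - 1‖ₑ ^ 2 * ‖fourierCoeff f n‖ₑ ^ 2 =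
      ∫⁻ t, ‖f (t + h) - f t‖ₑ ^ 2 ∂haarAddCircle := by
  have hint : ∀ g : C(AddCircle T, ℂ), Integrable g (haarAddCircle : Measure (AddCircle T)) :=
    fun g => g.continuous.integrable_of_hasCompactSupport (HasCompactSupport.of_compactSpace _)
  let g : C(AddCircle T, ℂ) := ⟨fun t => f (t + h), by fun_prop⟩
  have hg : ∀ n, fourierCoeff (g - f) n = (fourier n h - 1) * fourierCoeff f n := by
    intro n
    have h1 : fourierCoeff g n = fourier n h * fourierCoeff f n :=
      fourierCoeff_comp_add_right f h n
    have h2 : fourierCoeff ((g - f) + f) n = fourierCoeff (g - f) n + fourierCoeff f n :=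
      fourierCoeff.add (hint (g - f)) (hint f) ▸ rfl
    rw [sub_add_cancel] at h2
    linear_combination h1 - h2
  have := tsum_enorm_sq_fourierCoeff (g - f)
  simp only [hg, enorm_mul, mul_pow] at this
  exact this

end FourierCircle

/-- The multiplier of the `k`-th Fourier mode in the fractional seminorm of a function on the
circle is at least a multiple of `|k|^(2s) / (1 - s)`, uniformly in `s`: the increments
`h < 1 / |k|` suffice for this. -/
theorem ofReal_rpow_le_lintegral_fourier_sub_one {s : ℝ} (hs1 : s < 1) {k : ℤ}
    (hk : k ≠ 0) :
    ENNReal.ofReal (|(k : ℝ)| ^ (2 * s) / (8 * (1 - s))) ≤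
      ∫⁻ h in Ioo (0 : ℝ) 1, ‖fourier k (h : AddCircle (2 * Real.pi)) - 1‖ₑ ^ 2 *
        ENNReal.ofReal (h ^ (-1 - 2 * s)) := by
  set b : ℝ := 1 / |(k : ℝ)| with hb
  have hk1 : 1 ≤ |(k : ℝ)| := by exact_mod_cast Int.one_le_abs hk
  have hk0 : 0 < |(k : ℝ)| := by linarith
  have hb0 : 0 < b := by positivity
  have hb1 : b ≤ 1 := by rw [hb, div_le_one hk0]; exact hk1
  have hs : 0 < 2 - 2 * s := by linarith
  have hint : ∫⁻ h in Ioo (0 : ℝ) b, ENNReal.ofReal (|(k : ℝ)| ^ 2 / 4 * h ^ (1 - 2 * s)) =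
      ENNReal.ofReal (|(k : ℝ)| ^ (2 * s) / (8 * (1 - s))) := by
    rw [restrict_Ioo_eq_restrict_Ioc, ← ofReal_integral_eq_lintegral_ofReal,
      ← intervalIntegral.integral_of_le hb0.le, intervalIntegral.integral_const_mul,
      integral_rpow (Or.inl (by linarith))]
    · congr 1
      have h1 : (1 - 2 * s + 1) = 2 - 2 * s := by ring
      rw [h1, Real.zero_rpow hs.ne', sub_zero, hb, one_div, Real.inv_rpow hk0.le,
        ← Real.rpow_neg hk0.le]
      have h2 : |(k : ℝ)| ^ (-(2 - 2 * s)) = |(k : ℝ)| ^ (2 * s) / |(k : ℝ)| ^ 2 := by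
        rw [← Real.rpow_natCast, ← Real.rpow_sub hk0]
        congr 1
        push_cast
        ring
      rw [h2]
      have : 1 - s ≠ 0 := by linarith
      field_simp
      ring
    · refine Integrable.const_mul ?_ _
      have := intervalIntegral.intervalIntegrable_rpow' (a := 0) (b := b) (r := 1 - 2 * s)
        (by linarith)
      rwa [intervalIntegrable_iff_integrableOn_Ioc_of_le hb0.le] at this
    · filter_upwards [ae_restrict_mem measurableSet_Ioc] with h hh
      have := hh.1
      positivity
  rw [← hint]
  refine (setLIntegral_mono' measurableSet_Ioo fun h hh => ?_).trans
    (lintegral_mono_set (Ioo_subset_Ioo_right hb1))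
  have hh0 : 0 < h := hh.1
  have hkh : |(k : ℝ) * h| ≤ 1 := by
    rw [abs_mul, abs_of_pos hh0, ← le_div_iff₀' hk0]
    exact hh.2.le
  have hfou : fourier k (h : AddCircle (2 * Real.pi)) =
      Complex.exp (Complex.I * ((k * h : ℝ) : ℂ)) := by
    rw [fourier_coe_apply]
    congr 1
    push_cast
    have : (Real.pi : ℂ) ≠ 0 := by exact_mod_cast Real.pi_ne_zero
    field_simp
  have hnorm : |(k : ℝ) * h| / 2 ≤ ‖fourier k (h : AddCircle (2 * Real.pi)) - 1‖ := by
    rw [hfou, Complex.norm_exp_I_mul_ofReal_sub_one, norm_mul, Real.norm_eq_abs, Real.norm_eq_abs,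
      abs_two]
    have h3 := Real.mul_abs_le_abs_sin (x := (k : ℝ) * h / 2) (by
      rw [abs_div, abs_two]
      linarith [Real.pi_gt_three])
    rw [abs_div, abs_two] at h3
    have h4 : 2 / Real.pi * (|(k : ℝ) * h| / 2) ≥ |(k : ℝ) * h| / 4 := by
      have : (1 : ℝ) / 2 ≤ 2 / Real.pi := by
        rw [div_le_div_iff₀ (by norm_num) Real.pi_pos]
        linarith [Real.pi_lt_four]
      nlinarith [abs_nonneg ((k : ℝ) * h)]
    linarith
  rw [← ofReal_norm, ← ENNReal.ofReal_pow (norm_nonneg _), ← ENNReal.ofReal_mul (by positivity)]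
  refine ENNReal.ofReal_le_ofReal ?_
  have h5 : h ^ (1 - 2 * s) = h ^ 2 * h ^ (-1 - 2 * s) := by
    rw [← Real.rpow_natCast, ← Real.rpow_add hh0]
    congr 1
    push_cast
    ring
  rw [h5, ← mul_assoc]
  gcongr
  calc |(k : ℝ)| ^ 2 / 4 * h ^ 2 = (|(k : ℝ) * h| / 2) ^ 2 := by
        rw [abs_mul, abs_of_pos hh0]
        ring
    _ ≤ _ := by gcongr

/-- If a continuous function on the circle vanishes somewhere, its mean is controlled by its other
Fourier coefficients, because the Fourier series vanishes at that point. The Cauchy-Schwarz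
inequality makes the constant of order `1 / (2s - 1)`. -/
theorem enorm_sq_fourierCoeff_zero_le {T : ℝ} [Fact (0 < T)] {s : ℝ} (hs : 1 / 2 < s) (hs1 : s < 1)
    (f : C(AddCircle T, ℂ)) {θ₀ : AddCircle T} (hθ₀ : f θ₀ = 0) :
    ‖fourierCoeff f 0‖ₑ ^ 2 ≤ ENNReal.ofReal (4 / (2 * s - 1)) *
      ∑' k : ℤ, ENNReal.ofReal (|(k : ℝ)| ^ (2 * s)) * ‖fourierCoeff f k‖ₑ ^ 2 := by
  set S := ∑' k : ℤ, ENNReal.ofReal (|(k : ℝ)| ^ (2 * s)) * ‖fourierCoeff f k‖ₑ ^ 2 with hS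
  have hs' : 0 < 2 * s - 1 := by linarith
  let c : ℤ → ℂ := fun k => if k = 0 then 0 else fourierCoeff f k
  have hsum : (∑' k, ‖c k‖ₑ) ^ 2 ≤ ENNReal.ofReal (4 / (2 * s - 1)) * S := by
    let x : ℤ → ℝ≥0∞ := fun k => if k = 0 then 0 else ENNReal.ofReal (|(k : ℝ)| ^ (-s))
    let y : ℤ → ℝ≥0∞ := fun k => ENNReal.ofReal (|(k : ℝ)| ^ s) * ‖fourierCoeff f k‖ₑ
    have hxy : ∀ k, ‖c k‖ₑ = x k * y k := by
      intro k
      by_cases hk : k = 0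
      · simp [c, x, hk]
      · have hk0 : 0 < |(k : ℝ)| := by positivity
        simp only [c, x, y, hk, if_false, ← mul_assoc]
        rw [← ENNReal.ofReal_mul (by positivity), ← Real.rpow_add hk0]
        simp
    have hx2 : ∀ k, x k ^ 2 = if k = 0 then 0 else ENNReal.ofReal (|(k : ℝ)| ^ (-(2 * s))) := by
      intro k
      by_cases hk : k = 0
      · simp [x, hk]
      · simp only [x, hk, if_false]
        rw [← ENNReal.ofReal_pow (by positivity), ← Real.rpow_mul_natCast (abs_nonneg _)]
        congr 2
        push_cast
        ring
    have hy2 : ∀ k, y k ^ 2 = ENNReal.ofReal (|(k : ℝ)| ^ (2 * s)) * ‖fourierCoeff f k‖ₑ ^ 2 := by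
      intro k
      simp only [y]
      rw [mul_pow, ← ENNReal.ofReal_pow (by positivity), ← Real.rpow_mul_natCast (abs_nonneg _)]
      congr 3
      push_cast
      ring
    simp only [hxy]
    refine (ENNReal.sq_tsum_mul_le x y).trans ?_
    simp only [hx2, hy2]
    gcongr
    exact tsum_int_rpow_neg_le (by linarith) (by linarith)
  -- if `S` is finite, the Fourier series converges absolutely, hence pointwise to `f`
  rcases eq_or_ne S ⊤ with hS' | hS'
  · rw [hS', ENNReal.mul_top (ENNReal.ofReal_pos.2 (by positivity)).ne']
    exact le_top
  refine le_trans ?_ hsum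
  gcongr
  have hfin : ∑' k, ‖c k‖ₑ ≠ ⊤ := by
    intro h
    rw [h] at hsum
    exact (ENNReal.mul_lt_top ENNReal.ofReal_lt_top (lt_top_iff_ne_top.2 hS')).ne
      (top_le_iff.1 (by simpa using hsum))
  have hc : Summable c := by
    refine Summable.of_norm ?_
    simpa [toReal_enorm] using ENNReal.summable_toReal hfin
  have hc' : Summable (fourierCoeff f) :=
    (hc.update 0 (fourierCoeff f 0)).congr fun k => by
      by_cases hk : k = 0
      · subst hk; simp
      · simp [c, hk]
  have hpt := has_pointwise_sum_fourier_series_of_summable hc' θ₀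
  rw [hθ₀] at hpt
  have hpt' := hpt.update 0 (0 : ℂ)
  have heq : Function.update (fun k => fourierCoeff f k • fourier k θ₀) 0 0 =
      fun k => c k * fourier k θ₀ := by
    ext k
    by_cases hk : k = 0
    · subst hk; simp [c]
    · simp [c, hk]
  rw [heq] at hpt'
  have hval : ∑' k, c k * fourier k θ₀ = - fourierCoeff f 0 := by
    rw [hpt'.tsum_eq]
    simp
  rw [← enorm_neg, ← hval]
  refine enorm_tsum_le_tsum_enorm.trans (ENNReal.tsum_le_tsum fun k => ?_)
  have hone : ‖(fourier k θ₀ : ℂ)‖ₑ = 1 := by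
    rw [fourier_apply, ← ofReal_norm, Circle.norm_coe, ENNReal.ofReal_one]
  rw [enorm_mul, hone, mul_one]

/-- **Fractional Poincaré inequality on the circle** for continuous functions vanishing at some
point. The constant has the sharp order both as `s ↘ 1/2` and as `s ↗ 1`. -/
theorem lintegral_circle_enorm_sq_le {s : ℝ} (hs : 1 / 2 < s) (hs1 : s < 1)
    (f : C(AddCircle (2 * Real.pi), ℂ)) {θ₀ : AddCircle (2 * Real.pi)} (hθ₀ : f θ₀ = 0) :
    ∫⁻ θ, ‖f θ‖ₑ ^ 2 ≤ ENNReal.ofReal (40 * (1 - s) / (2 * s - 1)) *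
      ∫⁻ h in Ioo (0 : ℝ) 1, (∫⁻ θ, ‖f (θ + (h : AddCircle (2 * Real.pi))) - f θ‖ₑ ^ 2) *
        ENNReal.ofReal (h ^ (-1 - 2 * s)) := by
  have hs' : 0 < 2 * s - 1 := by linarith
  have hs1' : 0 < 1 - s := by linarith
  set S := ∑' k : ℤ, ENNReal.ofReal (|(k : ℝ)| ^ (2 * s)) * ‖fourierCoeff f k‖ₑ ^ 2 with hS
  have hL : ∑' k, ‖fourierCoeff f k‖ₑ ^ 2 ≤ ENNReal.ofReal (5 / (2 * s - 1)) * S := by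
    have h1 : ∑' k, ‖fourierCoeff f k‖ₑ ^ 2 ≤ ‖fourierCoeff f 0‖ₑ ^ 2 + S := by
      have : ∀ k, ‖fourierCoeff f k‖ₑ ^ 2 ≤ (if k = 0 then ‖fourierCoeff f 0‖ₑ ^ 2 else 0) +
          ENNReal.ofReal (|(k : ℝ)| ^ (2 * s)) * ‖fourierCoeff f k‖ₑ ^ 2 := by
        intro k
        by_cases hk : k = 0
        · subst hk; simp
        · have hk1 : 1 ≤ |(k : ℝ)| := by exact_mod_cast Int.one_le_abs hk
          have h3 : 1 ≤ ENNReal.ofReal (|(k : ℝ)| ^ (2 * s)) := by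
            rw [ENNReal.one_le_ofReal]
            exact Real.one_le_rpow hk1 (by linarith)
          simp only [hk, if_false, zero_add]
          exact le_mul_of_one_le_left zero_le h3
      refine (ENNReal.tsum_le_tsum this).trans ?_
      rw [ENNReal.tsum_add, tsum_ite_eq]
    refine h1.trans ((add_le_add_left (enorm_sq_fourierCoeff_zero_le hs hs1 f hθ₀) S).trans ?_)
    rw [← hS]
    nth_rewrite 2 [← one_mul S]
    rw [← add_mul, ← ENNReal.ofReal_one, ← ENNReal.ofReal_add (by positivity) (by norm_num)]
    gcongr
    rw [div_add_one hs'.ne']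
    gcongr
    linarith
  have hR : ENNReal.ofReal (1 / (8 * (1 - s))) * S ≤
      ∫⁻ h in Ioo (0 : ℝ) 1, (∫⁻ θ, ‖f (θ + (h : AddCircle (2 * Real.pi))) - f θ‖ₑ ^ 2
        ∂AddCircle.haarAddCircle) * ENNReal.ofReal (h ^ (-1 - 2 * s)) := by
    simp only [← tsum_enorm_sq_mul_fourier_sub_one f, ← ENNReal.tsum_mul_right]
    rw [lintegral_tsum (fun k => by fun_prop), hS, ← ENNReal.tsum_mul_left]
    refine ENNReal.tsum_le_tsum fun k => ?_
    simp only [mul_right_comm _ (‖fourierCoeff f k‖ₑ ^ 2)]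
    rw [lintegral_mul_const _ (by fun_prop), ← mul_assoc]
    gcongr
    rw [← ENNReal.ofReal_mul (by positivity)]
    by_cases hk : k = 0
    · subst hk
      simp [Real.zero_rpow (show 2 * s ≠ 0 by linarith)]
    · refine le_trans (le_of_eq ?_) (ofReal_rpow_le_lintegral_fourier_sub_one hs1 hk)
      congr 1
      ring
  have hS_le : S ≤ ENNReal.ofReal (8 * (1 - s)) *
      ∫⁻ h in Ioo (0 : ℝ) 1, (∫⁻ θ, ‖f (θ + (h : AddCircle (2 * Real.pi))) - f θ‖ₑ ^ 2
        ∂AddCircle.haarAddCircle) * ENNReal.ofReal (h ^ (-1 - 2 * s)) := by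
    calc S = ENNReal.ofReal (8 * (1 - s)) * (ENNReal.ofReal (1 / (8 * (1 - s))) * S) := by
          rw [← mul_assoc, ← ENNReal.ofReal_mul (by positivity), mul_one_div_cancel (by positivity)]
          simp
      _ ≤ _ := by gcongr
  -- all integrals over the circle are rescaled by `2π`
  simp only [AddCircle.volume_eq_smul_haarAddCircle, lintegral_smul_measure, smul_eq_mul, mul_assoc]
  rw [lintegral_const_mul' _ _ ENNReal.ofReal_ne_top, mul_left_comm]
  gcongr
  rw [← tsum_enorm_sq_fourierCoeff]
  refine hL.trans ((mul_le_mul_right hS_le _).trans (le_of_eq ?_))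
  rw [← mul_assoc, ← ENNReal.ofReal_mul (by positivity)]
  congr 2
  ring

/-! ### Polar coordinates and changes of variables -/

theorem lintegral_comp_add_smul {E : Type*} [NormedAddCommGroup E] [NormedSpace ℝ E]
    [MeasurableSpace E] [BorelSpace E] [FiniteDimensional ℝ E] (μ : Measure E) [μ.IsAddHaarMeasure]
    (f : E → ℝ≥0∞) (c : E) {R : ℝ} (hR : 0 < R) :
    ∫⁻ x, f (c + R • x) ∂μ =
      ENNReal.ofReal ((R ^ Module.finrank ℝ E)⁻¹) * ∫⁻ x, f x ∂μ := by
  have h1 := lintegral_map_equiv (μ := μ) (fun x => f (c + x))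
    (Homeomorph.smulOfNeZero R hR.ne' : E ≃ₜ E).toMeasurableEquiv
  have h2 : Measure.map (Homeomorph.smulOfNeZero R hR.ne' : E ≃ₜ E).toMeasurableEquiv μ =
      ENNReal.ofReal ((R ^ Module.finrank ℝ E)⁻¹) • μ := by
    rw [← abs_of_pos (inv_pos.2 (pow_pos hR (Module.finrank ℝ E)))]
    exact Measure.map_addHaar_smul μ hR.ne'
  rw [h2, lintegral_smul_measure, lintegral_add_left_eq_self, smul_eq_mul] at h1
  exact h1.symm

/-- The point with polar coordinates `(ρ, θ)` around `a`. -/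
noncomputable def circlePt (a : ℂ) (ρ : ℝ) (θ : AddCircle (2 * Real.pi)) : ℂ :=
  a + ρ * (AddCircle.toCircle θ : ℂ)

@[fun_prop]
theorem continuous_circlePt {X : Type*} [TopologicalSpace X] {a : X → ℂ} {ρ : X → ℝ}
    {θ : X → AddCircle (2 * Real.pi)} (ha : Continuous a) (hρ : Continuous ρ) (hθ : Continuous θ) :
    Continuous fun x => circlePt (a x) (ρ x) (θ x) := by
  have : Continuous fun x => (AddCircle.toCircle (θ x) : ℂ) :=
    continuous_subtype_val.comp (AddCircle.continuous_toCircle.comp hθ)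
  unfold circlePt
  fun_prop

theorem toCircle_coe_two_pi (x : ℝ) :
    ((AddCircle.toCircle (x : AddCircle (2 * Real.pi)) : Circle) : ℂ) =
      Complex.exp (x * Complex.I) := by
  rw [AddCircle.toCircle_apply_mk, Circle.coe_exp]
  congr 2
  push_cast
  have : (Real.pi : ℂ) ≠ 0 := by exact_mod_cast Real.pi_ne_zero
  field_simp

theorem norm_circlePt_sub (a : ℂ) (ρ : ℝ) (θ : AddCircle (2 * Real.pi)) :
    ‖circlePt a ρ θ - a‖ = |ρ| := by
  rw [circlePt, add_sub_cancel_left, norm_mul, Circle.norm_coe, mul_one, Complex.norm_real,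
    Real.norm_eq_abs]

/-- The arc and the radial segment joining two points bound their distance. -/
theorem norm_circlePt_sub_circlePt_le (a : ℂ) {ρ t : ℝ} (hρ : 0 ≤ ρ) (ht : 0 ≤ t)
    (θ : AddCircle (2 * Real.pi)) (σ : ℝ) :
    ‖circlePt a (ρ + t) (θ + (σ : AddCircle (2 * Real.pi))) - circlePt a ρ θ‖ ≤ t + ρ * |σ| := by
  have h1 : circlePt a (ρ + t) (θ + (σ : AddCircle (2 * Real.pi))) - circlePt a ρ θ =
      t * (AddCircle.toCircle (θ + (σ : AddCircle (2 * Real.pi))) : ℂ) +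
        ρ * ((AddCircle.toCircle θ : ℂ) * (Complex.exp (Complex.I * (σ : ℂ)) - 1)) := by
    rw [circlePt, circlePt, AddCircle.toCircle_add, Circle.coe_mul, toCircle_coe_two_pi,
      mul_comm Complex.I]
    push_cast
    ring
  rw [h1]
  refine (norm_add_le _ _).trans ?_
  simp only [norm_mul, Circle.norm_coe, mul_one, one_mul, Complex.norm_real, Real.norm_eq_abs,
    abs_of_nonneg hρ, abs_of_nonneg ht]
  gcongr
  simpa using Real.norm_exp_I_mul_ofReal_sub_one_le (x := σ)

/-- Integration in polar coordinates around `a`, with the angle in `ℝ / 2πℤ`. -/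
theorem lintegral_eq_lintegral_circlePt {g : ℂ → ℝ≥0∞} (hg : Measurable g) (a : ℂ) :
    ∫⁻ z, g z = ∫⁻ ρ in Ioi (0 : ℝ), ENNReal.ofReal ρ * ∫⁻ θ, g (circlePt a ρ θ) := by
  rw [← lintegral_add_left_eq_self _ a, ← Complex.lintegral_comp_polarCoord_symm,
    polarCoord_target, Measure.volume_eq_prod, ← Measure.prod_restrict, lintegral_prod]
  · refine lintegral_congr fun ρ => ?_
    rw [← AddCircle.lintegral_preimage _ (-Real.pi), restrict_Ioo_eq_restrict_Ioc,
      show -Real.pi + 2 * Real.pi = Real.pi by ring,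
      ← lintegral_const_mul' _ _ ENNReal.ofReal_ne_top]
    refine lintegral_congr fun θ => ?_
    rw [Complex.polarCoord_symm_apply, smul_eq_mul, circlePt, toCircle_coe_two_pi,
      Complex.exp_mul_I]
    push_cast
    rfl
  · have : Continuous fun p : ℝ × ℝ => a + Complex.polarCoord.symm p := by
      simp only [Complex.polarCoord_symm_apply]
      fun_prop
    exact (ENNReal.measurable_ofReal.comp measurable_fst |>.mul
      (hg.comp this.measurable)).aemeasurable

theorem setLIntegral_annulus_eq {g : ℂ → ℝ≥0∞} (hg : Measurable g) (a : ℂ) {r₁ r₂ : ℝ}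
    (hr : 0 ≤ r₁) :
    ∫⁻ z in {z | ‖z - a‖ ∈ Ioo r₁ r₂}, g z =
      ∫⁻ ρ in Ioo r₁ r₂, ENNReal.ofReal ρ * ∫⁻ θ, g (circlePt a ρ θ) := by
  have hA : MeasurableSet {z : ℂ | ‖z - a‖ ∈ Ioo r₁ r₂} :=
    (by fun_prop : Measurable fun z : ℂ => ‖z - a‖) measurableSet_Ioo
  have hsub : Ioo r₁ r₂ ⊆ Ioi 0 := fun x hx => lt_of_le_of_lt hr hx.1
  have hres := setLIntegral_indicator (μ := volume) measurableSet_Ioo (t := Ioi 0)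
    (s := Ioo r₁ r₂) fun ρ => ENNReal.ofReal ρ * ∫⁻ θ, g (circlePt a ρ θ)
  rw [inter_eq_left.2 hsub] at hres
  rw [← lintegral_indicator hA, lintegral_eq_lintegral_circlePt (hg.indicator hA) a, ← hres]
  refine setLIntegral_congr_fun measurableSet_Ioi fun ρ hρ => ?_
  have hn : ∀ θ, ‖circlePt a ρ θ - a‖ = ρ := fun θ => by
    rw [norm_circlePt_sub, abs_of_pos hρ]
  by_cases h : ρ ∈ Ioo r₁ r₂
  · simp only [indicator_of_mem h]
    congr 1
    refine lintegral_congr fun θ => ?_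
    rw [indicator_of_mem]
    change ‖_‖ ∈ Ioo r₁ r₂
    rwa [hn]
  · simp only [indicator_of_notMem h]
    have : ∀ θ, indicator {z | ‖z - a‖ ∈ Ioo r₁ r₂} g (circlePt a ρ θ) = 0 := fun θ => by
      rw [indicator_of_notMem]
      change ¬ ‖_‖ ∈ Ioo r₁ r₂
      rwa [hn]
    simp only [this, lintegral_zero, mul_zero]

/-! ### From the circles to the annulus -/

/-- An increment along a circle is averaged over detours through the points at distance
comparable to the length of the increment. -/
theorem lintegral_enorm_sq_increment_le {g : ℝ → AddCircle (2 * Real.pi) → ℝ}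
    (hg : Continuous fun q : ℝ × AddCircle (2 * Real.pi) => g q.1 q.2)
    {f : AddCircle (2 * Real.pi) → ℝ} (hf : Continuous f) {h : ℝ} (hh : 0 < h) :
    ENNReal.ofReal (h ^ 2) * ∫⁻ θ, ‖f (θ + (h : AddCircle (2 * Real.pi))) - f θ‖ₑ ^ 2 ≤
      2 * ∫⁻ t in Ioo 0 h, ∫⁻ σ in Ioo (-h) h,
        ∫⁻ θ, ‖g t (θ + (σ : AddCircle (2 * Real.pi))) - f θ‖ₑ ^ 2 := by
  set I := ∫⁻ θ, ‖f (θ + (h : AddCircle (2 * Real.pi))) - f θ‖ₑ ^ 2 with hI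
  have hgt : ∀ t, Continuous (g t) := fun t => hg.comp (by fun_prop : Continuous fun x => (t, x))
  set D : ℝ → ℝ → ℝ≥0∞ := fun t σ =>
    ∫⁻ θ, ‖g t (θ + (σ : AddCircle (2 * Real.pi))) - f θ‖ₑ ^ 2 with hD
  have hcoe : Continuous fun x : ℝ => (x : AddCircle (2 * Real.pi)) := AddCircle.continuous_mk' _
  have hDm : ∀ t, Measurable (D t) := fun t => by
    refine Measurable.lintegral_prod_right' (f := fun q : ℝ × AddCircle (2 * Real.pi) =>
      ‖g t (q.2 + (q.1 : AddCircle (2 * Real.pi))) - f q.2‖ₑ ^ 2) ?_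
    have := (hgt t).comp (continuous_snd.add (hcoe.comp continuous_fst) :
      Continuous fun q : ℝ × AddCircle (2 * Real.pi) => q.2 + (q.1 : AddCircle (2 * Real.pi)))
    have h2 := this.sub (hf.comp continuous_snd)
    exact h2.enorm.measurable.pow_const 2
  -- the detour from `θ` to `θ + h` through `θ + σ`, whose second leg is translated back by `h`
  have hpt : ∀ t σ : ℝ, I ≤ 2 * (D t (σ - h) + D t σ) := by
    intro t σ
    have hfirst : D t (σ - h) = ∫⁻ θ, ‖f (θ + (h : AddCircle (2 * Real.pi))) -
        g t (θ + (σ : AddCircle (2 * Real.pi)))‖ₑ ^ 2 := by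
      simp only [hD]
      rw [← lintegral_add_right_eq_self _ (h : AddCircle (2 * Real.pi))]
      refine lintegral_congr fun θ => ?_
      rw [← enorm_neg, neg_sub]
      congr 4
      rw [add_assoc, ← AddCircle.coe_add, add_sub_cancel]
    have hm1 : Measurable fun θ => ‖g t (θ + (σ : AddCircle (2 * Real.pi))) - f θ‖ₑ ^ 2 :=
      (Continuous.enorm (by have := hgt t; fun_prop)).measurable.pow_const 2
    rw [hfirst, hD, hI, ← lintegral_add_right _ hm1,
      ← lintegral_const_mul' _ _ ENNReal.ofNat_ne_top]
    refine lintegral_mono fun θ => ?_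
    have h1 : ∀ a b c : ℝ, ‖a - c‖ₑ ^ 2 ≤ 2 * (‖a - b‖ₑ ^ 2 + ‖b - c‖ₑ ^ 2) := by
      intro a b c
      simp only [← ofReal_norm, ← ENNReal.ofReal_pow (norm_nonneg _)]
      rw [← ENNReal.ofReal_add (by positivity) (by positivity), ← ENNReal.ofReal_ofNat 2,
        ← ENNReal.ofReal_mul (by norm_num)]
      refine ENNReal.ofReal_le_ofReal ?_
      simp only [Real.norm_eq_abs, sq_abs]
      nlinarith [sq_nonneg (a - b - (b - c))]
    exact h1 _ _ _
  have hσ : ∀ t, ENNReal.ofReal h * I ≤ 2 * ∫⁻ σ in Ioo (-h) h, D t σ := by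
    intro t
    have h1 : ENNReal.ofReal h * I = ∫⁻ σ in Ioo 0 h, I := by
      rw [setLIntegral_const, Real.volume_Ioo, sub_zero, mul_comm]
    have h2 : ∫⁻ σ in Ioo 0 h, D t (σ - h) = ∫⁻ σ in Ioo (-h) 0, D t σ := by
      rw [← lintegral_indicator measurableSet_Ioo, ← lintegral_indicator measurableSet_Ioo,
        ← lintegral_sub_right_eq_self ((Ioo (-h) 0).indicator (D t)) h]
      refine lintegral_congr fun σ => ?_
      have : σ ∈ Ioo 0 h ↔ σ - h ∈ Ioo (-h) 0 := by
        simp only [mem_Ioo]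
        constructor <;> rintro ⟨h1, h2⟩ <;> constructor <;> linarith
      by_cases hmem : σ ∈ Ioo 0 h
      · rw [indicator_of_mem hmem, indicator_of_mem (this.1 hmem)]
      · rw [indicator_of_notMem hmem, indicator_of_notMem (fun h => hmem (this.2 h))]
    rw [h1]
    refine (lintegral_mono (hpt t)).trans ?_
    rw [lintegral_const_mul _ (by have := hDm t; fun_prop), lintegral_add_right _ (hDm t), h2,
      ← lintegral_union measurableSet_Ioo]
    · gcongr
      rintro x (hx | hx)
      · exact ⟨hx.1, hx.2.trans hh⟩
      · exact ⟨by linarith [hx.1], hx.2⟩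
    · rw [Set.disjoint_left]
      intro x hx hx'
      exact lt_asymm hx.2 hx'.1
  calc ENNReal.ofReal (h ^ 2) * I = ∫⁻ t in Ioo 0 h, ENNReal.ofReal h * I := by
        rw [setLIntegral_const, Real.volume_Ioo, sub_zero, pow_two, ENNReal.ofReal_mul hh.le]
        ring
    _ ≤ ∫⁻ t in Ioo 0 h, 2 * ∫⁻ σ in Ioo (-h) h, D t σ := lintegral_mono hσ
    _ = _ := by rw [lintegral_const_mul' _ _ (by norm_num)]

theorem lintegral_Ioi_rpow_le {s m : ℝ} (hs : 0 < s) (hm : 0 < m) :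
    ∫⁻ h in Ioi m, ENNReal.ofReal (h ^ (-3 - 2 * s)) ≤ ENNReal.ofReal (m ^ (-2 - 2 * s)) := by
  rw [← ofReal_integral_eq_lintegral_ofReal (integrableOn_Ioi_rpow_of_lt (by linarith) hm),
    integral_Ioi_rpow_of_lt (by linarith) hm]
  · refine ENNReal.ofReal_le_ofReal ?_
    have h1 : (-3 - 2 * s + 1) = -2 - 2 * s := by ring
    rw [h1, neg_div, ← div_neg]
    exact div_le_self (by positivity) (by linarith)
  · filter_upwards [ae_restrict_mem measurableSet_Ioi] with h hh
    have : 0 < h := hm.trans hh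
    positivity

/-- Tonelli's theorem turns an average over `max t |σ| < h` into the weight
`(max t |σ|) ^ (-2 - 2s)`. -/
theorem lintegral_average_le {s : ℝ} (hs : 0 < s) {I : ℝ → ℝ≥0∞} {D : ℝ → ℝ → ℝ≥0∞}
    (hD : Measurable fun q : ℝ × ℝ => D q.1 q.2)
    (hI : ∀ h ∈ Ioo (0 : ℝ) 1, ENNReal.ofReal (h ^ 2) * I h ≤
      2 * ∫⁻ t in Ioo 0 h, ∫⁻ σ in Ioo (-h) h, D t σ) :
    ∫⁻ h in Ioo (0 : ℝ) 1, I h * ENNReal.ofReal (h ^ (-1 - 2 * s)) ≤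
      2 * ∫⁻ t in Ioo (0 : ℝ) 1, ∫⁻ σ in Ioo (-1 : ℝ) 1,
        D t σ * ENNReal.ofReal (max t |σ| ^ (-2 - 2 * s)) := by
  set J : ℝ → ℝ → ℝ → ℝ≥0∞ := fun h t σ =>
    {q : ℝ × ℝ × ℝ | max q.2.1 |q.2.2| < q.1}.indicator
      (fun q => D q.2.1 q.2.2 * ENNReal.ofReal (q.1 ^ (-3 - 2 * s))) (h, t, σ) with hJ
  have hset : MeasurableSet {q : ℝ × ℝ × ℝ | max q.2.1 |q.2.2| < q.1} :=
    (isOpen_lt (by fun_prop) (by fun_prop)).measurableSet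
  have hJm : Measurable fun q : ℝ × ℝ × ℝ => J q.1 q.2.1 q.2.2 := by
    refine Measurable.indicator ?_ hset
    exact (hD.comp measurable_snd).mul (by fun_prop)
  have hstep : ∀ h ∈ Ioo (0 : ℝ) 1, I h * ENNReal.ofReal (h ^ (-1 - 2 * s)) ≤
      2 * ∫⁻ t in Ioo (0 : ℝ) 1, ∫⁻ σ in Ioo (-1 : ℝ) 1, J h t σ := by
    intro h hh
    have hh0 : 0 < h := hh.1
    have hsplit : h ^ (-1 - 2 * s) = h ^ 2 * h ^ (-3 - 2 * s) := by
      rw [← Real.rpow_natCast, ← Real.rpow_add hh0]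
      congr 1
      push_cast
      ring
    rw [hsplit, ENNReal.ofReal_mul (by positivity), ← mul_assoc, mul_comm (I h)]
    refine (mul_le_mul_left (hI h hh) _).trans ?_
    rw [mul_assoc, ← lintegral_mul_const' _ _ ENNReal.ofReal_ne_top]
    refine mul_le_mul_right ?_ 2
    have hsub : Ioo 0 h ⊆ Ioo (0 : ℝ) 1 := Ioo_subset_Ioo_right hh.2.le
    have hsub' : Ioo (-h) h ⊆ Ioo (-1 : ℝ) 1 := Ioo_subset_Ioo (by linarith [hh.2]) hh.2.le
    refine (setLIntegral_mono' measurableSet_Ioo fun t ht => ?_).trans (lintegral_mono_set hsub)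
    rw [← lintegral_mul_const' _ _ ENNReal.ofReal_ne_top]
    refine (setLIntegral_mono' measurableSet_Ioo fun σ hσ => ?_).trans (lintegral_mono_set hsub')
    simp only [hJ]
    rw [indicator_of_mem]
    exact max_lt ht.2 (abs_lt.2 hσ)
  refine (setLIntegral_mono' measurableSet_Ioo hstep).trans ?_
  rw [lintegral_const_mul' _ _ (by norm_num)]
  refine mul_le_mul_right ?_ 2
  rw [lintegral_lintegral_swap]
  · refine setLIntegral_mono' measurableSet_Ioo fun t ht => ?_
    rw [lintegral_lintegral_swap]
    · refine lintegral_mono fun σ => ?_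
      have hm : 0 < max t |σ| := lt_max_of_lt_left ht.1
      calc ∫⁻ h in Ioo (0 : ℝ) 1, J h t σ
          ≤ ∫⁻ h, (Ioi (max t |σ|)).indicator
              (fun h => D t σ * ENNReal.ofReal (h ^ (-3 - 2 * s))) h := by
            refine (setLIntegral_le_lintegral _ _).trans (lintegral_mono fun h => ?_)
            exact le_of_eq rfl
        _ = D t σ * ∫⁻ h in Ioi (max t |σ|), ENNReal.ofReal (h ^ (-3 - 2 * s)) := by
            rw [lintegral_indicator measurableSet_Ioi, lintegral_const_mul _ (by fun_prop)]
        _ ≤ _ := by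
            gcongr
            exact lintegral_Ioi_rpow_le hs hm
    · exact (hJm.comp (by fun_prop : Measurable fun q : ℝ × ℝ => (q.1, t, q.2))).aemeasurable
  · refine Measurable.aemeasurable ?_
    exact Measurable.lintegral_prod_right' (f := fun q : (ℝ × ℝ) × ℝ => J q.1.1 q.1.2 q.2)
      (hJm.comp (by fun_prop : Measurable fun q : (ℝ × ℝ) × ℝ => (q.1.1, q.1.2, q.2)))

/-- Passage from polar coordinates near the circle of radius `ρ` back to the plane: the Jacobian of
`(t, σ) ↦ (ρ + R t, θ + σ)` is at least `2R²`. -/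
theorem lintegral_circlePt_window_le {G : ℂ → ℝ≥0∞} (hG : Measurable G) (a : ℂ) {R ρ : ℝ}
    (hR : 0 < R) (hρ : 2 * R ≤ ρ) (θ : AddCircle (2 * Real.pi)) :
    ∫⁻ t in Ioo (0 : ℝ) 1, ∫⁻ σ in Ioo (-1 : ℝ) 1,
        G (circlePt a (ρ + R * t) (θ + (σ : AddCircle (2 * Real.pi)))) ≤
      ENNReal.ofReal ((2 * R ^ 2)⁻¹) * ∫⁻ z, G z := by
  set H : ℝ → ℝ≥0∞ := fun r => ∫⁻ ψ, G (circlePt a r ψ) with hH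
  have hinner : ∀ r, ∫⁻ σ in Ioo (-1 : ℝ) 1,
      G (circlePt a r (θ + (σ : AddCircle (2 * Real.pi)))) ≤ H r := by
    intro r
    rw [hH]
    simp only
    rw [← lintegral_add_left_eq_self _ θ, ← AddCircle.lintegral_preimage _ (-Real.pi)]
    refine lintegral_mono_set fun x hx => ?_
    constructor <;> linarith [hx.1, hx.2, Real.pi_gt_three]
  have hweight : ∀ r ∈ Ioo ρ (ρ + R),
      H r ≤ ENNReal.ofReal ((2 * R)⁻¹) * (ENNReal.ofReal r * H r) := by
    intro r hr
    rw [← mul_assoc, ← ENNReal.ofReal_mul (by positivity)]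
    refine le_mul_of_one_le_left zero_le ?_
    rw [ENNReal.one_le_ofReal, inv_mul_eq_div, one_le_div (by positivity)]
    linarith [hr.1]
  calc ∫⁻ t in Ioo (0 : ℝ) 1, ∫⁻ σ in Ioo (-1 : ℝ) 1,
        G (circlePt a (ρ + R * t) (θ + (σ : AddCircle (2 * Real.pi))))
      ≤ ∫⁻ t in Ioo (0 : ℝ) 1, H (ρ + R * t) := lintegral_mono fun t => hinner _
    _ = ∫⁻ t, (Ioo ρ (ρ + R)).indicator H (ρ + R • t) := by
        rw [← lintegral_indicator measurableSet_Ioo]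
        refine lintegral_congr fun t => ?_
        have : t ∈ Ioo (0 : ℝ) 1 ↔ ρ + R • t ∈ Ioo ρ (ρ + R) := by
          simp only [mem_Ioo, smul_eq_mul]
          constructor <;> rintro ⟨h1, h2⟩ <;> constructor <;> nlinarith
        by_cases ht : t ∈ Ioo (0 : ℝ) 1
        · rw [indicator_of_mem ht, indicator_of_mem (this.1 ht), smul_eq_mul]
        · rw [indicator_of_notMem ht, indicator_of_notMem (fun h => ht (this.2 h))]
    _ = ENNReal.ofReal R⁻¹ * ∫⁻ r in Ioo ρ (ρ + R), H r := by
        rw [lintegral_comp_add_smul volume _ ρ hR, lintegral_indicator measurableSet_Ioo]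
        simp
    _ ≤ ENNReal.ofReal R⁻¹ * (ENNReal.ofReal ((2 * R)⁻¹) * ∫⁻ z, G z) := by
        gcongr
        rw [lintegral_eq_lintegral_circlePt hG a, ← lintegral_const_mul' _ _ ENNReal.ofReal_ne_top]
        refine (setLIntegral_mono' measurableSet_Ioo hweight).trans (lintegral_mono_set ?_)
        exact fun r hr => lt_trans (by linarith) hr.1
    _ = _ := by
        rw [← mul_assoc, ← ENNReal.ofReal_mul (by positivity)]
        congr 2
        field_simp

theorem measurable_gagliardo_integrand {E : Type*} [NormedAddCommGroup E] [MeasurableSpace E]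
    [BorelSpace E] [SecondCountableTopology E] {u : E → ℝ} (hu : Measurable u) (p : ℝ) :
    Measurable fun q : E × E => ‖u q.1 - u q.2‖ₑ ^ 2 / ‖q.1 - q.2‖ₑ ^ p := by
  have h1 : Measurable fun q : E × E => u q.1 - u q.2 :=
    (hu.comp measurable_fst).sub (hu.comp measurable_snd)
  have h2 : Measurable fun q : E × E => q.1 - q.2 := measurable_fst.sub measurable_snd
  exact (h1.enorm.pow_const 2).div (h2.enorm.pow_const p)

/-- A detour of size `m = max t |σ|` has length at most `9 R m`, which bounds the weight
`m ^ (-2 - 2s)` by the Gagliardo kernel. -/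
theorem kernel_detour_le {s : ℝ} (hs : 0 < s) (u : ℂ → ℝ) (a : ℂ) {R ρ t : ℝ} (hR : 0 < R)
    (hρ : 0 ≤ ρ) (hρR : ρ ≤ 8 * R) (ht : 0 < t) (σ : ℝ) (θ : AddCircle (2 * Real.pi)) :
    ‖u (circlePt a (ρ + R * t) (θ + (σ : AddCircle (2 * Real.pi)))) - u (circlePt a ρ θ)‖ₑ ^ 2 *
        ENNReal.ofReal (max t |σ| ^ (-2 - 2 * s)) ≤
      ENNReal.ofReal ((9 * R) ^ (2 + 2 * s)) * (‖u (circlePt a ρ θ) -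
        u (circlePt a (ρ + R * t) (θ + (σ : AddCircle (2 * Real.pi))))‖ₑ ^ 2 /
        ‖circlePt a ρ θ -
          circlePt a (ρ + R * t) (θ + (σ : AddCircle (2 * Real.pi)))‖ₑ ^ (2 + 2 * s)) := by
  have hm : 0 < max t |σ| := lt_max_of_lt_left ht
  set x := circlePt a ρ θ
  set y := circlePt a (ρ + R * t) (θ + (σ : AddCircle (2 * Real.pi)))
  have hdist : ‖x - y‖ ≤ 9 * R * max t |σ| := by
    rw [norm_sub_rev]
    refine (norm_circlePt_sub_circlePt_le a hρ (mul_nonneg hR.le ht.le) θ σ).trans ?_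
    have h1 : R * t ≤ R * max t |σ| := by gcongr; exact le_max_left _ _
    have h2 : ρ * |σ| ≤ (8 * R) * max t |σ| := by
      gcongr
      exact le_max_right _ _
    linarith
  have hpow : ‖x - y‖ₑ ^ (2 + 2 * s) ≤
      ENNReal.ofReal ((9 * R) ^ (2 + 2 * s)) * ENNReal.ofReal (max t |σ| ^ (2 + 2 * s)) := by
    rw [← ENNReal.ofReal_mul (by positivity), ← Real.mul_rpow (by positivity) hm.le,
      ← ofReal_norm, ENNReal.ofReal_rpow_of_nonneg (norm_nonneg _) (by linarith)]
    exact ENNReal.ofReal_le_ofReal (Real.rpow_le_rpow (norm_nonneg _) hdist (by linarith))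
  have hinv : ENNReal.ofReal (max t |σ| ^ (-2 - 2 * s)) =
      (ENNReal.ofReal (max t |σ| ^ (2 + 2 * s)))⁻¹ := by
    rw [← ENNReal.ofReal_inv_of_pos (by positivity), ← Real.rpow_neg hm.le]
    congr 2
    ring
  have h9 : ENNReal.ofReal ((9 * R) ^ (2 + 2 * s)) ≠ 0 :=
    (ENNReal.ofReal_pos.2 (by positivity)).ne'
  rw [← enorm_neg, neg_sub, hinv, mul_comm (ENNReal.ofReal _), ENNReal.div_eq_inv_mul,
    mul_comm _ (‖u x - u y‖ₑ ^ 2), mul_assoc]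
  gcongr
  calc (ENNReal.ofReal (max t |σ| ^ (2 + 2 * s)))⁻¹
      = (ENNReal.ofReal ((9 * R) ^ (2 + 2 * s)) *
          ENNReal.ofReal (max t |σ| ^ (2 + 2 * s)))⁻¹ *
          ENNReal.ofReal ((9 * R) ^ (2 + 2 * s)) := by
        rw [ENNReal.mul_inv (Or.inl h9) (Or.inl ENNReal.ofReal_ne_top), mul_right_comm,
          ENNReal.inv_mul_cancel h9 ENNReal.ofReal_ne_top, one_mul]
    _ ≤ _ := by gcongr

theorem lintegral_circlePt_swap {F : ℂ → ℂ → ℝ≥0∞} (hF : Measurable fun q : ℂ × ℂ => F q.1 q.2)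
    (a : ℂ) (ρ R : ℝ) :
    ∫⁻ t in Ioo (0 : ℝ) 1, ∫⁻ σ in Ioo (-1 : ℝ) 1, ∫⁻ θ, F (circlePt a ρ θ)
      (circlePt a (ρ + R * t) (θ + (σ : AddCircle (2 * Real.pi)))) =
      ∫⁻ θ, ∫⁻ t in Ioo (0 : ℝ) 1, ∫⁻ σ in Ioo (-1 : ℝ) 1, F (circlePt a ρ θ)
        (circlePt a (ρ + R * t) (θ + (σ : AddCircle (2 * Real.pi)))) := by
  have hFc : Measurable fun q : AddCircle (2 * Real.pi) × ℝ × ℝ =>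
      F (circlePt a ρ q.1) (circlePt a (ρ + R * q.2.1)
        (q.1 + (q.2.2 : AddCircle (2 * Real.pi)))) := by
    have hcoe : Continuous fun x : ℝ => (x : AddCircle (2 * Real.pi)) :=
      AddCircle.continuous_mk' _
    have h1 : Continuous fun q : AddCircle (2 * Real.pi) × ℝ × ℝ =>
        q.1 + (q.2.2 : AddCircle (2 * Real.pi)) :=
      continuous_fst.add (hcoe.comp (by fun_prop))
    have h2 : Continuous fun q : AddCircle (2 * Real.pi) × ℝ × ℝ => circlePt a ρ q.1 := by
      fun_prop
    have h3 : Continuous fun q : AddCircle (2 * Real.pi) × ℝ × ℝ =>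
        circlePt a (ρ + R * q.2.1) (q.1 + (q.2.2 : AddCircle (2 * Real.pi))) := by fun_prop
    exact Measurable.comp (g := fun q : ℂ × ℂ => F q.1 q.2) hF (h2.measurable.prodMk h3.measurable)
  set Φ : AddCircle (2 * Real.pi) → ℝ → ℝ → ℝ≥0∞ := fun θ t σ => F (circlePt a ρ θ)
    (circlePt a (ρ + R * t) (θ + (σ : AddCircle (2 * Real.pi)))) with hΦ
  have hΦm : Measurable fun q : AddCircle (2 * Real.pi) × ℝ × ℝ => Φ q.1 q.2.1 q.2.2 := hFc
  change ∫⁻ t in Ioo (0 : ℝ) 1, ∫⁻ σ in Ioo (-1 : ℝ) 1, ∫⁻ θ, Φ θ t σ =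
    ∫⁻ θ, ∫⁻ t in Ioo (0 : ℝ) 1, ∫⁻ σ in Ioo (-1 : ℝ) 1, Φ θ t σ
  clear_value Φ
  symm
  rw [lintegral_lintegral_swap]
  · refine lintegral_congr fun t => ?_
    rw [lintegral_lintegral_swap]
    exact Measurable.aemeasurable (Measurable.comp hΦm
      (by fun_prop : Measurable fun q : AddCircle (2 * Real.pi) × ℝ => (q.1, t, q.2)))
  · refine Measurable.aemeasurable ?_
    exact Measurable.lintegral_prod_right'
      (f := fun q : (AddCircle (2 * Real.pi) × ℝ) × ℝ => Φ q.1.1 q.1.2 q.2)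
      (Measurable.comp hΦm (by fun_prop : Measurable fun q : (AddCircle (2 * Real.pi) × ℝ) × ℝ =>
        (q.1.1, q.1.2, q.2)))

/-- The one-dimensional inequality on a circle of radius `ρ ∈ (2R, 8R)`, with the one-dimensional
seminorm replaced by the planar kernel. -/
theorem lintegral_circlePt_enorm_sq_le {s : ℝ} (hs : 1 / 2 < s) (hs1 : s < 1) {u : ℂ → ℝ}
    (hu : Continuous u) {a : ℂ} {R ρ : ℝ} (hR : 0 < R) (hρ : ρ ∈ Ioo (2 * R) (8 * R))
    {θ₀ : AddCircle (2 * Real.pi)} (hθ₀ : u (circlePt a ρ θ₀) = 0) :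
    ∫⁻ θ, ‖u (circlePt a ρ θ)‖ₑ ^ 2 ≤
      ENNReal.ofReal (9 ^ 4 * 40 * (1 - s) / (2 * s - 1) * R ^ (2 * s)) *
        ∫⁻ θ, ∫⁻ w, ‖u (circlePt a ρ θ) - u w‖ₑ ^ 2 / ‖circlePt a ρ θ - w‖ₑ ^ (2 + 2 * s) := by
  have hs' : 0 < 2 * s - 1 := by linarith
  have hs1' : 0 < 1 - s := by linarith
  have hρ0 : 0 < ρ := lt_trans (by positivity) hρ.1
  have hcoe : Continuous fun x : ℝ => (x : AddCircle (2 * Real.pi)) := AddCircle.continuous_mk' _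
  set F : ℂ → ℂ → ℝ≥0∞ := fun z w => ‖u z - u w‖ₑ ^ 2 / ‖z - w‖ₑ ^ (2 + 2 * s) with hF
  have hFm : Measurable fun q : ℂ × ℂ => F q.1 q.2 :=
    measurable_gagliardo_integrand hu.measurable (2 + 2 * s)
  set v : ℝ → AddCircle (2 * Real.pi) → ℝ := fun t θ => u (circlePt a (ρ + R * t) θ) with hv
  have hvc : Continuous fun q : ℝ × AddCircle (2 * Real.pi) => v q.1 q.2 := by
    simp only [hv]
    fun_prop
  have hv0 : Continuous fun θ => u (circlePt a ρ θ) := by fun_prop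
  set D : ℝ → ℝ → ℝ≥0∞ := fun t σ =>
    ∫⁻ θ, ‖v t (θ + (σ : AddCircle (2 * Real.pi))) - u (circlePt a ρ θ)‖ₑ ^ 2 with hD
  have hDm : Measurable fun q : ℝ × ℝ => D q.1 q.2 := by
    refine Measurable.lintegral_prod_right' (f := fun q : (ℝ × ℝ) × AddCircle (2 * Real.pi) =>
      ‖v q.1.1 (q.2 + (q.1.2 : AddCircle (2 * Real.pi))) - u (circlePt a ρ q.2)‖ₑ ^ 2) ?_
    refine (Continuous.enorm ?_).measurable.pow_const 2
    have h1 : Continuous fun q : (ℝ × ℝ) × AddCircle (2 * Real.pi) =>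
        (q.1.1, q.2 + (q.1.2 : AddCircle (2 * Real.pi))) :=
      (by fun_prop : Continuous fun q : (ℝ × ℝ) × AddCircle (2 * Real.pi) => q.1.1).prodMk
        (continuous_snd.add (hcoe.comp (by fun_prop)))
    exact (hvc.comp h1).sub (hv0.comp continuous_snd)
  have hkernel : ∀ t ∈ Ioo (0 : ℝ) 1, ∀ σ : ℝ,
      D t σ * ENNReal.ofReal (max t |σ| ^ (-2 - 2 * s)) ≤
        ENNReal.ofReal ((9 * R) ^ (2 + 2 * s)) * ∫⁻ θ, F (circlePt a ρ θ)
          (circlePt a (ρ + R * t) (θ + (σ : AddCircle (2 * Real.pi)))) := by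
    intro t ht σ
    rw [← lintegral_const_mul' _ _ ENNReal.ofReal_ne_top,
      ← lintegral_mul_const' _ _ ENNReal.ofReal_ne_top]
    exact lintegral_mono fun θ => kernel_detour_le (by linarith) u a hR hρ0.le hρ.2.le ht.1 σ θ
  have henorm : ∀ x : ℝ, ‖(x : ℂ)‖ₑ = ‖x‖ₑ := fun x => by
    rw [← ofReal_norm, Complex.norm_real, ofReal_norm]
  have hcircle := lintegral_circle_enorm_sq_le hs hs1
    ⟨fun θ => (u (circlePt a ρ θ) : ℂ), by fun_prop⟩ (θ₀ := θ₀) (by simp [hθ₀])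
  simp only [ContinuousMap.coe_mk, ← Complex.ofReal_sub, henorm] at hcircle
  have haverage := lintegral_average_le (s := s) (by linarith) hDm
    (I := fun h => ∫⁻ θ, ‖u (circlePt a ρ (θ + (h : AddCircle (2 * Real.pi)))) -
      u (circlePt a ρ θ)‖ₑ ^ 2)
    (fun h hh => lintegral_enorm_sq_increment_le hvc hv0 hh.1)
  have hswap := lintegral_circlePt_swap hFm a ρ R
  calc ∫⁻ θ, ‖u (circlePt a ρ θ)‖ₑ ^ 2
      ≤ ENNReal.ofReal (40 * (1 - s) / (2 * s - 1)) * (2 * ∫⁻ t in Ioo (0 : ℝ) 1,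
          ∫⁻ σ in Ioo (-1 : ℝ) 1, D t σ * ENNReal.ofReal (max t |σ| ^ (-2 - 2 * s))) := by
        refine hcircle.trans ?_
        gcongr
    _ ≤ ENNReal.ofReal (40 * (1 - s) / (2 * s - 1)) * (2 *
          (ENNReal.ofReal ((9 * R) ^ (2 + 2 * s)) * (ENNReal.ofReal ((2 * R ^ 2)⁻¹) *
            ∫⁻ θ, ∫⁻ w, F (circlePt a ρ θ) w))) := by
        refine mul_le_mul_right (mul_le_mul_right ?_ _) _
        calc ∫⁻ t in Ioo (0 : ℝ) 1, ∫⁻ σ in Ioo (-1 : ℝ) 1,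
              D t σ * ENNReal.ofReal (max t |σ| ^ (-2 - 2 * s))
            ≤ ∫⁻ t in Ioo (0 : ℝ) 1, ∫⁻ σ in Ioo (-1 : ℝ) 1,
              ENNReal.ofReal ((9 * R) ^ (2 + 2 * s)) * ∫⁻ θ, F (circlePt a ρ θ)
                (circlePt a (ρ + R * t) (θ + (σ : AddCircle (2 * Real.pi)))) :=
              setLIntegral_mono' measurableSet_Ioo fun t ht =>
                lintegral_mono fun σ => hkernel t ht σ
          _ = ENNReal.ofReal ((9 * R) ^ (2 + 2 * s)) *
              ∫⁻ θ, ∫⁻ t in Ioo (0 : ℝ) 1, ∫⁻ σ in Ioo (-1 : ℝ) 1, F (circlePt a ρ θ)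
                (circlePt a (ρ + R * t) (θ + (σ : AddCircle (2 * Real.pi)))) := by
              rw [← hswap, ← lintegral_const_mul' _ _ ENNReal.ofReal_ne_top]
              refine lintegral_congr fun t => ?_
              rw [lintegral_const_mul' _ _ ENNReal.ofReal_ne_top]
          _ ≤ _ := by
              gcongr
              rw [← lintegral_const_mul' _ _ ENNReal.ofReal_ne_top]
              exact lintegral_mono fun θ => lintegral_circlePt_window_le
                (hFm.comp (by fun_prop : Measurable fun w : ℂ => (circlePt a ρ θ, w))) a hR
                hρ.1.le θ
    _ ≤ _ := by
        rw [← ENNReal.ofReal_ofNat 2]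
        simp only [← mul_assoc]
        rw [← ENNReal.ofReal_mul (by positivity), ← ENNReal.ofReal_mul (by positivity),
          ← ENNReal.ofReal_mul (by positivity)]
        refine mul_le_mul_left (ENNReal.ofReal_le_ofReal ?_) _
        have h9 : (9 : ℝ) ^ (2 + 2 * s) ≤ 9 ^ (4 : ℕ) := by
          rw [← Real.rpow_natCast]
          exact Real.rpow_le_rpow_of_exponent_le (by norm_num) (by push_cast; linarith)
        have hRR : R ^ (2 + 2 * s) = R ^ 2 * R ^ (2 * s) := by
          rw [Real.rpow_add hR]
          norm_cast
        rw [Real.mul_rpow (by norm_num) hR.le, hRR]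
        calc 40 * (1 - s) / (2 * s - 1) * 2 * (9 ^ (2 + 2 * s) * (R ^ 2 * R ^ (2 * s))) *
              (2 * R ^ 2)⁻¹ = 9 ^ (2 + 2 * s) * (40 * (1 - s) / (2 * s - 1) * R ^ (2 * s)) := by
              field_simp
          _ ≤ 9 ^ 4 * (40 * (1 - s) / (2 * s - 1) * R ^ (2 * s)) := by gcongr
          _ = _ := by ring

/-- The local Poincaré inequality on an annulus, for a continuous function that vanishes somewhere
on every circle of the annulus. -/
theorem setLIntegral_annulus_enorm_sq_le {s : ℝ} (hs : 1 / 2 < s) (hs1 : s < 1) {u : ℂ → ℝ}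
    (hu : Continuous u) {a : ℂ} {R : ℝ} (hR : 0 < R)
    (hz : ∀ ρ : ℝ, ∃ θ : ℝ, u (a + ρ * Complex.exp (θ * Complex.I)) = 0) :
    ∫⁻ z in {z | ‖z - a‖ ∈ Ioo (2 * R) (8 * R)}, ‖u z‖ₑ ^ 2 ≤
      ENNReal.ofReal (9 ^ 4 * 40 * (1 - s) / (2 * s - 1) * R ^ (2 * s)) *
        ∫⁻ z in {z | ‖z - a‖ ∈ Ioo (2 * R) (8 * R)},
          ∫⁻ w, ‖u z - u w‖ₑ ^ 2 / ‖z - w‖ₑ ^ (2 + 2 * s) := by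
  have hΦ : Measurable fun z => ∫⁻ w, ‖u z - u w‖ₑ ^ 2 / ‖z - w‖ₑ ^ (2 + 2 * s) :=
    (measurable_gagliardo_integrand hu.measurable (2 + 2 * s)).lintegral_prod_right'
  rw [setLIntegral_annulus_eq (hu.enorm.measurable.pow_const 2) a (by positivity),
    setLIntegral_annulus_eq hΦ a (by positivity), ← lintegral_const_mul' _ _ ENNReal.ofReal_ne_top]
  refine setLIntegral_mono' measurableSet_Ioo fun ρ hρ => ?_
  obtain ⟨θ, hθ⟩ := hz ρ
  rw [mul_left_comm]
  gcongr
  exact lintegral_circlePt_enorm_sq_le hs hs1 hu hR hρ (θ₀ := (θ : AddCircle (2 * Real.pi)))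
    (by rwa [circlePt, toCircle_coe_two_pi])

/-! ### From annuli to the plane -/

/-- Averaging over discs: every point lies in discs `B_r(c)` for a set of centres `c` of measure
`π r²`. -/
theorem lintegral_setLIntegral_ball {g : ℂ → ℝ≥0∞} (hg : Measurable g) (r : ℝ) :
    ∫⁻ c, ∫⁻ z in Metric.ball c r, g z = ENNReal.ofReal r ^ 2 * NNReal.pi * ∫⁻ z, g z := by
  have hset : MeasurableSet {q : ℂ × ℂ | dist q.2 q.1 < r} :=
    (isOpen_lt (by fun_prop) (by fun_prop)).measurableSet
  set J : ℂ → ℂ → ℝ≥0∞ := fun c z =>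
    {q : ℂ × ℂ | dist q.2 q.1 < r}.indicator (fun q => g q.2) (c, z) with hJ
  have hJm : Measurable (Function.uncurry J) := (hg.comp measurable_snd).indicator hset
  have h1 : ∀ c, ∫⁻ z in Metric.ball c r, g z = ∫⁻ z, J c z := fun c => by
    rw [← lintegral_indicator Metric.isOpen_ball.measurableSet]
    rfl
  have h2 : ∀ z, ∫⁻ c, J c z = ENNReal.ofReal r ^ 2 * NNReal.pi * g z := fun z => by
    have : ∀ c, J c z = (Metric.ball z r).indicator (fun _ => g z) c := fun c => by
      have hiff : (c, z) ∈ {q : ℂ × ℂ | dist q.2 q.1 < r} ↔ c ∈ Metric.ball z r := by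
        rw [Metric.mem_ball, dist_comm]
        rfl
      by_cases hc : c ∈ Metric.ball z r
      · rw [indicator_of_mem hc, hJ]
        exact indicator_of_mem (hiff.2 hc) _
      · rw [indicator_of_notMem hc, hJ]
        exact indicator_of_notMem (fun h => hc (hiff.1 h)) _
    simp only [this]
    rw [lintegral_indicator Metric.isOpen_ball.measurableSet, setLIntegral_const,
      Complex.volume_ball, mul_comm]
  simp only [h1]
  rw [lintegral_lintegral_swap hJm.aemeasurable]
  simp only [h2]
  rw [lintegral_const_mul _ hg]

/-- Every disc of radius `2R` contains a point outside `U`. The annulus around such a point, taken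
in the disc centred at `c + 5R`, contains the disc `B_R(c)`; averaging the local inequality over
`c` replaces a covering argument. -/
theorem lintegral_enorm_sq_le_of_isSimplyConnected {s : ℝ} (hs : 1 / 2 < s) (hs1 : s < 1)
    {U : Set ℂ} (hU : IsOpen U) (hU' : IsSimplyConnected U) {R : ℝ} (hR : 0 < R)
    (hball : ∀ y : ℂ, ∃ a ∉ U, dist a y < 2 * R) {u : ℂ → ℝ} (hu : Continuous u)
    (huU : ∀ z ∉ U, u z = 0) :
    ∫⁻ z, ‖u z‖ₑ ^ 2 ≤
      ENNReal.ofReal (225 * 9 ^ 4 * 40 * (1 - s) / (2 * s - 1) * R ^ (2 * s)) *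
        ∫⁻ z, ∫⁻ w, ‖u z - u w‖ₑ ^ 2 / ‖z - w‖ₑ ^ (2 + 2 * s) := by
  have hs' : 0 < 2 * s - 1 := by linarith
  have hs1' : 0 < 1 - s := by linarith
  set Φ : ℂ → ℝ≥0∞ := fun z => ∫⁻ w, ‖u z - u w‖ₑ ^ 2 / ‖z - w‖ₑ ^ (2 + 2 * s) with hΦ
  have hΦm : Measurable Φ :=
    (measurable_gagliardo_integrand hu.measurable (2 + 2 * s)).lintegral_prod_right'
  set K : ℝ := 9 ^ 4 * 40 * (1 - s) / (2 * s - 1) * R ^ (2 * s) with hK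
  have hlocal : ∀ c, ∫⁻ z in Metric.ball c R, ‖u z‖ₑ ^ 2 ≤
      ENNReal.ofReal K * ∫⁻ z in Metric.ball c (15 * R), Φ z := by
    intro c
    obtain ⟨a, haU, ha⟩ := hball (c + (5 * R : ℝ))
    have hca : ‖(5 * R : ℝ) - (a - c)‖ < 2 * R := by
      rw [dist_eq_norm, ← norm_neg] at ha
      rwa [show ((5 * R : ℝ) : ℂ) - (a - c) = -(a - (c + (5 * R : ℝ))) by ring]
    have h5 : ‖((5 * R : ℝ) : ℂ)‖ = 5 * R := by
      rw [Complex.norm_real, Real.norm_of_nonneg (by positivity)]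
    have hac1 : 3 * R < ‖a - c‖ := by
      have := norm_sub_norm_le ((5 * R : ℝ) : ℂ) (a - c)
      linarith
    have hac2 : ‖a - c‖ < 7 * R := by
      have := norm_sub_norm_le (a - c) ((5 * R : ℝ) : ℂ)
      rw [norm_sub_rev (a - c) ((5 * R : ℝ) : ℂ)] at this
      linarith
    have hsub1 : Metric.ball c R ⊆ {z | ‖z - a‖ ∈ Ioo (2 * R) (8 * R)} := by
      intro z hz
      rw [Metric.mem_ball, dist_eq_norm] at hz
      have h1 := norm_sub_norm_le (a - c) (z - c)
      have h2 := norm_sub_le (z - c) (a - c)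
      rw [sub_sub_sub_cancel_right] at h1 h2
      rw [norm_sub_rev a z] at h1
      constructor <;> linarith
    have hsub2 : {z | ‖z - a‖ ∈ Ioo (2 * R) (8 * R)} ⊆ Metric.ball c (15 * R) := by
      intro z hz
      have hz2 : ‖z - a‖ < 8 * R := hz.2
      rw [Metric.mem_ball, dist_eq_norm]
      have := norm_add_le (z - a) (a - c)
      rw [sub_add_sub_cancel] at this
      linarith
    refine (lintegral_mono_set hsub1).trans
      ((setLIntegral_annulus_enorm_sq_le hs hs1 hu hR fun ρ => ?_).trans ?_)
    · obtain ⟨θ, hθ⟩ := exists_circle_notMem_of_isSimplyConnected hU hU' haU ρ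
      exact ⟨θ, huU _ hθ⟩
    · gcongr
  have hint := lintegral_mono (μ := (volume : Measure ℂ)) hlocal
  rw [lintegral_const_mul' _ _ ENNReal.ofReal_ne_top, lintegral_setLIntegral_ball hΦm,
    lintegral_setLIntegral_ball (hu.enorm.measurable.pow_const 2)] at hint
  set b : ℝ≥0∞ := ENNReal.ofReal R ^ 2 * NNReal.pi with hb
  have hb0 : b ≠ 0 := by
    have : ENNReal.ofReal R ≠ 0 := (ENNReal.ofReal_pos.2 hR).ne'
    have : (NNReal.pi : ℝ≥0∞) ≠ 0 := by simpa using NNReal.pi_ne_zero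
    positivity
  have hbt : b ≠ ⊤ := ENNReal.mul_ne_top (ENNReal.pow_ne_top ENNReal.ofReal_ne_top)
    ENNReal.coe_ne_top
  have hb15 : ENNReal.ofReal (15 * R) ^ 2 * NNReal.pi = b * ENNReal.ofReal 225 := by
    rw [hb, ENNReal.ofReal_mul (by norm_num), mul_pow, ← ENNReal.ofReal_pow (by norm_num)]
    norm_num
    ring
  rw [hb15, mul_assoc b, mul_left_comm _ b] at hint
  refine ((ENNReal.mul_le_mul_iff_right hb0 hbt).1 hint).trans (le_of_eq ?_)
  rw [← mul_assoc, ← ENNReal.ofReal_mul (by positivity)]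
  congr 2
  rw [hK]
  ring

theorem gagliardoSeminorm_two_sq {s : ℝ} (u : RN 2 → ℝ) :
    gagliardoSeminorm s 2 u ^ 2 = ∫⁻ x, ∫⁻ y, ‖u x - u y‖ₑ ^ 2 / ‖x - y‖ₑ ^ (2 + 2 * s) := by
  rw [gagliardoSeminorm, ← ENNReal.rpow_natCast, ← ENNReal.rpow_mul]
  norm_num
  simp only [mul_comm s 2]

theorem eLpNorm_two_sq {α : Type*} [MeasurableSpace α] (μ : Measure α) (u : α → ℝ) :
    eLpNorm u 2 μ ^ 2 = ∫⁻ x, ‖u x‖ₑ ^ 2 ∂μ := by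
  rw [eLpNorm_eq_lintegral_rpow_enorm_toReal (by norm_num) (by norm_num), ← ENNReal.rpow_natCast,
    ← ENNReal.rpow_mul]
  norm_num

theorem inradius_pos {N : ℕ} {Ω : Set (RN N)} (hΩ : IsOpen Ω) (hne : Ω.Nonempty) :
    0 < inradius Ω := by
  obtain ⟨x, hx⟩ := hne
  obtain ⟨ρ, hρ, hball⟩ := Metric.isOpen_iff.1 hΩ x hx
  exact lt_of_lt_of_le (ENNReal.ofReal_pos.2 hρ) (le_iSup₂ (f := fun (ρ : ℝ)
    (_ : 0 < ρ ∧ ∃ x ∈ Ω, Metric.ball x ρ ⊆ Ω) => ENNReal.ofReal ρ) ρ ⟨hρ, x, hx, hball⟩)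

theorem exists_notMem_dist_lt_of_inradius_lt {N : ℕ} {Ω : Set (RN N)} {r : ℝ} (hr : 0 < r)
    (h : inradius Ω < ENNReal.ofReal r) (y : RN N) : ∃ a ∉ Ω, dist a y < r := by
  by_contra! hcon
  have hball : Metric.ball y r ⊆ Ω := fun a ha => by
    by_contra haΩ
    exact absurd ha (not_lt.2 (hcon a haΩ))
  refine absurd h (not_lt.2 ?_)
  exact le_iSup₂ (f := fun (ρ : ℝ)
    (_ : 0 < ρ ∧ ∃ x ∈ Ω, Metric.ball x ρ ⊆ Ω) => ENNReal.ofReal ρ) r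
    ⟨hr, y, hball (Metric.mem_ball_self hr), hball⟩

/-- The fractional Makai-Hayman inequality for continuous functions that vanish off `Ω`. -/
theorem eLpNorm_sq_le_gagliardoSeminorm_sq {s : ℝ} (hs : 1 / 2 < s) (hs1 : s < 1)
    {Ω : Set (RN 2)} (hΩ : IsOpen Ω) (hΩ' : IsSimplyConnected Ω) {R : ℝ} (hR : 0 < R)
    (hrad : inradius Ω < ENNReal.ofReal (2 * R)) {φ : RN 2 → ℝ} (hφ : Continuous φ)
    (hφΩ : ∀ x ∉ Ω, φ x = 0) :
    eLpNorm φ 2 volume ^ 2 ≤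
      ENNReal.ofReal (225 * 9 ^ 4 * 40 * (1 - s) / (2 * s - 1) * R ^ (2 * s)) *
        gagliardoSeminorm s 2 φ ^ 2 := by
  let e : ℂ ≃ₗᵢ[ℝ] RN 2 := Complex.orthonormalBasisOneI.repr
  have he : MeasurePreserving e := e.measurePreserving
  have hemb : MeasurableEmbedding e := e.toHomeomorph.measurableEmbedding
  rw [eLpNorm_two_sq, gagliardoSeminorm_two_sq, ← he.lintegral_comp_emb hemb,
    ← he.lintegral_comp_emb hemb]
  -- the inner integral, under the binder of the outer one
  simp only [← he.lintegral_comp_emb hemb (fun y => ‖φ _ - φ y‖ₑ ^ 2 / ‖_ - y‖ₑ ^ (2 + 2 * s))]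
  have hdist : ∀ z w, ‖e z - e w‖ₑ = ‖z - w‖ₑ := fun z w => by
    rw [← map_sub, ← ofReal_norm, e.norm_map, ofReal_norm]
  simp only [hdist]
  refine lintegral_enorm_sq_le_of_isSimplyConnected hs hs1 (U := e ⁻¹' Ω)
    (hΩ.preimage e.continuous) ?_ hR (fun y => ?_) (hφ.comp e.continuous) (fun z hz => hφΩ _ hz)
  · exact (e.toHomeomorph.isSimplyConnected_preimage).2 hΩ'
  · obtain ⟨a, ha, hay⟩ := exists_notMem_dist_lt_of_inradius_lt (by positivity) hrad (e y)
    refine ⟨e.symm a, by simpa using ha, ?_⟩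
    rwa [← e.dist_map, e.apply_symm_apply]

/-! ### Density -/

theorem gagliardoSeminorm_congr_ae {N : ℕ} {s p : ℝ} {u v : RN N → ℝ} (h : u =ᵐ[volume] v) :
    gagliardoSeminorm s p u = gagliardoSeminorm s p v := by
  rw [gagliardoSeminorm, gagliardoSeminorm]
  congr 1
  refine lintegral_congr_ae ?_
  filter_upwards [h] with x hx
  refine lintegral_congr_ae ?_
  filter_upwards [h] with y hy
  rw [hx, hy]

theorem ENNReal.add_sq_le_two_mul (a b : ℝ≥0∞) : (a + b) ^ 2 ≤ 2 * (a ^ 2 + b ^ 2) := by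
  have := ENNReal.rpow_add_le_mul_rpow_add_rpow a b (p := 2) (by norm_num)
  norm_num at this
  exact this

theorem lintegral_gagliardo_sub_le {E : Type*} [NormedAddCommGroup E] [MeasurableSpace E]
    [BorelSpace E] [SecondCountableTopology E] (μ : Measure E) [SFinite μ] {u v : E → ℝ}
    (hu : Measurable u) (p : ℝ) :
    ∫⁻ x, ∫⁻ y, ‖(u - v) x - (u - v) y‖ₑ ^ 2 / ‖x - y‖ₑ ^ p ∂μ ∂μ ≤
      2 * (∫⁻ x, ∫⁻ y, ‖u x - u y‖ₑ ^ 2 / ‖x - y‖ₑ ^ p ∂μ ∂μ +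
        ∫⁻ x, ∫⁻ y, ‖v x - v y‖ₑ ^ 2 / ‖x - y‖ₑ ^ p ∂μ ∂μ) := by
  have hmu := measurable_gagliardo_integrand hu p
  have hmux : ∀ x, Measurable fun y => ‖u x - u y‖ₑ ^ 2 / ‖x - y‖ₑ ^ p := fun x =>
    ((measurable_const.sub hu).enorm.pow_const 2).div
      ((measurable_const.sub measurable_id).enorm.pow_const p)
  have hmuI : Measurable fun x => ∫⁻ y, ‖u x - u y‖ₑ ^ 2 / ‖x - y‖ₑ ^ p ∂μ :=
    hmu.lintegral_prod_right'
  rw [← lintegral_add_left hmuI, ← lintegral_const_mul' _ _ ENNReal.ofNat_ne_top]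
  refine lintegral_mono fun x => ?_
  rw [← lintegral_add_left (hmux x), ← lintegral_const_mul' _ _ ENNReal.ofNat_ne_top]
  refine lintegral_mono fun y => ?_
  simp only [Pi.sub_apply]
  rw [ENNReal.div_add_div_same, ← mul_div_assoc]
  refine ENNReal.div_le_div_right (le_trans ?_ (ENNReal.add_sq_le_two_mul _ _)) _
  gcongr
  rw [sub_sub_sub_comm]
  exact enorm_sub_le

theorem gagliardoSeminorm_sub_sq_le {s : ℝ} {u v : RN 2 → ℝ} (hu : Measurable u) :
    gagliardoSeminorm s 2 (u - v) ^ 2 ≤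
      2 * (gagliardoSeminorm s 2 u ^ 2 + gagliardoSeminorm s 2 v ^ 2) := by
  rw [gagliardoSeminorm_two_sq, gagliardoSeminorm_two_sq, gagliardoSeminorm_two_sq]
  exact lintegral_gagliardo_sub_le volume hu (2 + 2 * s)

/-- An inequality between `‖·‖_{L²}` and the seminorm passes from the test functions to their
closure, here with the constant multiplied by `4`. -/
theorem eLpNorm_sq_le_of_memFracSobolevZero {s : ℝ} {Ω : Set (RN 2)} {M : ℝ≥0∞} (hM : M ≠ ⊤)
    (htest : ∀ φ : RN 2 → ℝ, IsTestFunction Ω φ →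
      eLpNorm φ 2 volume ^ 2 ≤ M * gagliardoSeminorm s 2 φ ^ 2)
    {u : RN 2 → ℝ} (hu : MemFracSobolevZero s Ω u) :
    eLpNorm u 2 volume ^ 2 ≤ 4 * M * gagliardoSeminorm s 2 u ^ 2 := by
  obtain ⟨⟨⟨hum, -⟩, -⟩, hdense⟩ := hu
  have key : ∀ ε : ℝ≥0∞, 0 < ε → eLpNorm u 2 volume ^ 2 ≤
      4 * M * gagliardoSeminorm s 2 u ^ 2 + (2 + 4 * M) * ε ^ 2 := by
    intro ε hε
    obtain ⟨φ, hφ, hφε⟩ := hdense ε hε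
    have hφm : Measurable φ := hφ.1.continuous.measurable
    have h1 : eLpNorm (u - φ) 2 volume ≤ ε := le_self_add.trans hφε.le
    have h2 : gagliardoSeminorm s 2 (u - φ) ≤ ε := le_add_self.trans hφε.le
    have h3 : gagliardoSeminorm s 2 φ ^ 2 ≤
        2 * (gagliardoSeminorm s 2 u ^ 2 + ε ^ 2) := by
      have hae := hum.ae_eq_mk
      have := gagliardoSeminorm_sub_sq_le (s := s) hum.stronglyMeasurable_mk.measurable
        (v := hum.mk u - φ)
      rw [sub_sub_cancel, ← gagliardoSeminorm_congr_ae hae,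
        ← gagliardoSeminorm_congr_ae (hae.sub (ae_eq_refl φ))] at this
      refine this.trans ?_
      gcongr
    have h4 : eLpNorm u 2 volume ≤ eLpNorm (u - φ) 2 volume + eLpNorm φ 2 volume := by
      have := eLpNorm_add_le (hum.sub hφm.aestronglyMeasurable) hφm.aestronglyMeasurable
        (p := 2) (μ := volume) (by norm_num)
      rwa [sub_add_cancel] at this
    calc eLpNorm u 2 volume ^ 2
        ≤ (eLpNorm (u - φ) 2 volume + eLpNorm φ 2 volume) ^ 2 := by gcongr
      _ ≤ 2 * (eLpNorm (u - φ) 2 volume ^ 2 + eLpNorm φ 2 volume ^ 2) :=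
          ENNReal.add_sq_le_two_mul _ _
      _ ≤ 2 * (ε ^ 2 + M * (2 * (gagliardoSeminorm s 2 u ^ 2 + ε ^ 2))) := by
          gcongr
          refine (htest φ hφ).trans ?_
          gcongr
      _ = _ := by ring
  have hlim : Tendsto (fun ε : ℝ≥0∞ => 4 * M * gagliardoSeminorm s 2 u ^ 2 + (2 + 4 * M) * ε ^ 2)
      (𝓝[>] 0) (𝓝 (4 * M * gagliardoSeminorm s 2 u ^ 2 + (2 + 4 * M) * 0 ^ 2)) := by
    have hc : Tendsto (fun ε : ℝ≥0∞ => ε ^ 2) (𝓝[>] 0) (𝓝 (0 ^ 2)) :=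
      ((ENNReal.continuous_pow 2).tendsto 0).mono_left nhdsWithin_le_nhds
    exact (ENNReal.Tendsto.const_mul hc (Or.inr (by finiteness))).const_add _
  have := ge_of_tendsto hlim (by filter_upwards [self_mem_nhdsWithin] with ε hε using key ε hε)
  simpa using this

/-- The quotient `[u]² / ‖u‖²` has no `0 / 0` problem: the inequality itself shows that a nonzero
`u` has a positive seminorm, and `‖u‖_{L²(Ω)} ≤ ‖u‖_{L²(ℝ²)}`. -/
theorem le_fracEigenvalue {s : ℝ} {Ω : Set (RN 2)} {M : ℝ≥0∞} (hM : M ≠ ⊤)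
    (htest : ∀ φ : RN 2 → ℝ, IsTestFunction Ω φ →
      eLpNorm φ 2 volume ^ 2 ≤ M * gagliardoSeminorm s 2 φ ^ 2) :
    (4 * M)⁻¹ ≤ fracEigenvalue s Ω := by
  refine le_iInf₂ fun u hu => ?_
  have hle := eLpNorm_sq_le_of_memFracSobolevZero hM htest hu.1
  have hG : gagliardoSeminorm s 2 u ^ 2 ≠ 0 := by
    intro h
    rw [h, mul_zero, nonpos_iff_eq_zero, pow_eq_zero_iff two_ne_zero,
      eLpNorm_eq_zero_iff hu.1.1.1.1 two_ne_zero] at hle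
    exact hu.2 hle
  have hG' : gagliardoSeminorm s 2 u ^ 2 ≠ ⊤ := ENNReal.pow_ne_top hu.1.1.2.ne
  rw [ENNReal.le_div_iff_mul_le (Or.inr hG) (Or.inr hG'), mul_comm, ← div_eq_mul_inv]
  refine ENNReal.div_le_of_le_mul' (le_trans ?_ hle)
  gcongr
  exact Measure.restrict_le_self

/-! ### Upper bounds for the Cheeger constants -/

/-- The divergence theorem on a square of side `l`: each of the four sides contributes at most
`l`. -/
theorem setIntegral_vecDivergence_square_le {φ : RN 2 → RN 2} (hφ : ContDiff ℝ 1 φ)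
    (hφ1 : ∀ x, ‖φ x‖ ≤ 1) (c : Fin 2 → ℝ) {l : ℝ} (hl : 0 ≤ l) :
    ∫ x in {y : RN 2 | y.ofLp ∈ Icc c (c + fun _ => l)}, vecDivergence φ x ≤ 4 * l := by
  -- the divergence theorem is available in `Fin 2 → ℝ`, with the same Lebesgue measure
  have hmp : MeasurePreserving (WithLp.toLp 2 : (Fin 2 → ℝ) → RN 2) :=
    PiLp.volume_preserving_toLp (Fin 2)
  have hemb : MeasurableEmbedding (WithLp.toLp 2 : (Fin 2 → ℝ) → RN 2) :=
    (MeasurableEquiv.toLp 2 (Fin 2 → ℝ)).measurableEmbedding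
  have hset : (WithLp.toLp 2 : (Fin 2 → ℝ) → RN 2) ⁻¹'
      {y : RN 2 | y.ofLp ∈ Icc c (c + fun _ => l)} = Icc c (c + fun _ => l) := rfl
  rw [← hmp.setIntegral_preimage_emb hemb, hset]
  let L : (Fin 2 → ℝ) ≃L[ℝ] RN 2 := (EuclideanSpace.equiv (Fin 2) ℝ).symm
  let f' : Fin 2 → (Fin 2 → ℝ) → (Fin 2 → ℝ) →L[ℝ] ℝ := fun i x =>
    (EuclideanSpace.proj i).comp ((fderiv ℝ φ (L x)).comp (L : (Fin 2 → ℝ) →L[ℝ] RN 2))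
  have hdiv : ∀ x, vecDivergence φ (WithLp.toLp 2 x) = ∑ i, f' i x (Pi.single i 1) := by
    intro x
    rfl
  have hcont : Continuous fun x => fderiv ℝ φ x := hφ.continuous_fderiv one_ne_zero
  have hdcont : Continuous fun x => ∑ i, f' i x (Pi.single i 1) := by
    refine continuous_finsetSum _ fun i _ => ?_
    have h1 : Continuous fun x => fderiv ℝ φ (L x) (L (Pi.single i 1)) :=
      (hcont.comp L.continuous).clm_apply continuous_const
    exact (EuclideanSpace.proj (𝕜 := ℝ) i).continuous.comp h1
  have key := integral_divergence_of_hasFDerivAt_off_countable' (n := 1) (E := ℝ)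
    c (c + fun _ => l) (fun i => by simpa using hl) (fun i x => φ (L x) i) f' ∅ countable_empty
    (fun i => ((EuclideanSpace.proj (𝕜 := ℝ) i).continuous.comp
      (hφ.continuous.comp L.continuous)).continuousOn)
    (fun x _ i => (EuclideanSpace.proj (𝕜 := ℝ) i).hasFDerivAt.comp x
      (((hφ.differentiable one_ne_zero) (L x)).hasFDerivAt.comp x L.hasFDerivAt))
    (hdcont.continuousOn.integrableOn_compact isCompact_Icc)
  simp only [hdiv]
  rw [key]
  have hcoord : ∀ x i, ‖φ x i‖ ≤ 1 := fun x i => (PiLp.norm_apply_le (φ x) i).trans (hφ1 x)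
  have hface : ∀ (i : Fin 2) (g : (Fin 1 → ℝ) → ℝ), (∀ y, ‖g y‖ ≤ 1) →
      |∫ y in Icc (c ∘ i.succAbove) ((c + fun _ => l) ∘ i.succAbove), g y| ≤ l := by
    intro i g hg
    have hvol : volume (Icc (c ∘ i.succAbove) ((c + fun _ => l) ∘ i.succAbove)) =
        ENNReal.ofReal l := by
      rw [Real.volume_Icc_pi]
      simp
    have := norm_setIntegral_le_of_norm_le_const (μ := volume) (f := g)
      (s := Icc (c ∘ i.succAbove) ((c + fun _ => l) ∘ i.succAbove)) (C := 1)
      (by rw [hvol]; exact ENNReal.ofReal_lt_top) (fun y _ => hg y)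
    rwa [Measure.real, hvol, ENNReal.toReal_ofReal hl, one_mul] at this
  calc _ ≤ ∑ i : Fin 2, (l + l) := Finset.sum_le_sum fun i _ => by
        have h1 := hface i (fun y => φ (L (i.insertNth (c i + l) y)) i)
          (fun y => hcoord _ _)
        have h2 := hface i (fun y => φ (L (i.insertNth (c i) y)) i) (fun y => hcoord _ _)
        exact (sub_le_sub (abs_le.1 h1).2 (abs_le.1 h2).1).trans_eq (sub_neg_eq_add l l)
    _ = 4 * l := by
        simp
        ring

/-- If a disc of radius `l` lies in `Ω`, then the square of side `l` with the same centre shows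
that `h₁(Ω) ≤ 4 / l`. -/
theorem cheegerConstant_le_of_ball_subset {Ω : Set (RN 2)} {x : RN 2} {l : ℝ} (hl : 0 < l)
    (hball : Metric.ball x l ⊆ Ω) : cheegerConstant Ω ≤ ENNReal.ofReal (4 / l) := by
  set c : Fin 2 → ℝ := x.ofLp - fun _ => l / 2 with hc
  set E : Set (RN 2) := {y : RN 2 | y.ofLp ∈ Icc c (c + fun _ => l)} with hE
  have hEball : E ⊆ Metric.ball x l := by
    intro y hy
    have hyi : ∀ i, dist (y i) (x i) ≤ l / 2 := fun i => by
      have h1 := hy.1 i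
      have h2 := hy.2 i
      simp only [hc, Pi.sub_apply, Pi.add_apply] at h1 h2
      rw [Real.dist_eq, abs_le]
      constructor <;> linarith
    rw [Metric.mem_ball, EuclideanSpace.dist_eq, Fin.sum_univ_two]
    refine (Real.sqrt_lt' hl).2 ?_
    have h0 := hyi 0
    have h1 := hyi 1
    have := dist_nonneg (x := y 0) (y := x 0)
    have := dist_nonneg (x := y 1) (y := x 1)
    nlinarith
  have hEm : MeasurableSet E :=
    (MeasurableEquiv.toLp 2 (Fin 2 → ℝ)).symm.measurable measurableSet_Icc
  have hvol : volume E = ENNReal.ofReal (l ^ 2) := by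
    have := (EuclideanSpace.volume_preserving_symm_measurableEquiv_toLp (Fin 2)).measure_preimage
      (measurableSet_Icc (a := c) (b := c + fun _ => l)).nullMeasurableSet
    refine this.trans ?_
    rw [Real.volume_Icc_pi]
    simp [pow_two, ENNReal.ofReal_mul hl.le]
  have hper : deGiorgiPerimeter E ≤ ENNReal.ofReal (4 * l) := iSup₂_le fun φ hφ =>
    ENNReal.ofReal_le_ofReal (setIntegral_vecDivergence_square_le hφ.1 hφ.2.2 c hl.le)
  have hvol0 : 0 < volume E := by
    rw [hvol]
    exact ENNReal.ofReal_pos.2 (by positivity)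
  refine (iInf₂_le E ⟨hEball.trans hball, Metric.isBounded_ball.subset hEball, hEm, hvol0⟩).trans ?_
  rw [hvol]
  refine (ENNReal.div_le_div_right hper _).trans (le_of_eq ?_)
  rw [← ENNReal.ofReal_div_of_pos (by positivity)]
  congr 1
  field_simp

/-- The scaling law of the `s`-perimeter of discs. -/
theorem fracPerimeter_ball {s : ℝ} (hs : 0 < s) (c : RN 2) {r : ℝ} (hr : 0 < r) :
    fracPerimeter s (Metric.ball c r) =
      ENNReal.ofReal (r ^ (2 - s)) * fracPerimeter s (Metric.ball (0 : RN 2) 1) := by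
  have hfin : Module.finrank ℝ (RN 2) = 2 := by simp
  have hscale : ∀ f : RN 2 → ℝ≥0∞,
      ∫⁻ x, f x = ENNReal.ofReal (r ^ 2) * ∫⁻ x, f (c + r • x) := by
    intro f
    rw [lintegral_comp_add_smul volume f c hr, hfin, ← mul_assoc,
      ← ENNReal.ofReal_mul (by positivity), mul_inv_cancel₀ (by positivity), ENNReal.ofReal_one,
      one_mul]
  have hind : ∀ x : RN 2, (Metric.ball c r).indicator (fun _ => (1 : ℝ)) (c + r • x) =
      (Metric.ball (0 : RN 2) 1).indicator (fun _ => (1 : ℝ)) x := by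
    intro x
    have : c + r • x ∈ Metric.ball c r ↔ x ∈ Metric.ball (0 : RN 2) 1 := by
      rw [Metric.mem_ball, dist_eq_norm, add_sub_cancel_left, norm_smul, mem_ball_zero_iff,
        Real.norm_of_nonneg hr.le]
      exact mul_lt_iff_lt_one_right hr
    by_cases hx : x ∈ Metric.ball (0 : RN 2) 1
    · rw [indicator_of_mem hx, indicator_of_mem (this.2 hx)]
    · rw [indicator_of_notMem hx, indicator_of_notMem (fun h => hx (this.1 h))]
  have hk : ENNReal.ofReal (r ^ (2 + s)) ≠ 0 := (ENNReal.ofReal_pos.2 (by positivity)).ne'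
  have hdist : ∀ x y : RN 2, ‖c + r • x - (c + r • y)‖ₑ ^ (2 + s) =
      ENNReal.ofReal (r ^ (2 + s)) * ‖x - y‖ₑ ^ (2 + s) := by
    intro x y
    rw [add_sub_add_left_eq_sub, ← smul_sub, enorm_smul,
      ENNReal.mul_rpow_of_nonneg _ _ (by linarith), Real.enorm_eq_ofReal hr.le,
      ENNReal.ofReal_rpow_of_pos hr]
  have hdiv : ∀ a b : ℝ≥0∞, a / (ENNReal.ofReal (r ^ (2 + s)) * b) =
      ENNReal.ofReal (r ^ (2 + s))⁻¹ * (a / b) := by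
    intro a b
    rw [div_eq_mul_inv, ENNReal.mul_inv (Or.inl hk) (Or.inl ENNReal.ofReal_ne_top),
      ENNReal.ofReal_inv_of_pos (by positivity), div_eq_mul_inv]
    ring
  simp only [fracPerimeter, gagliardoSeminorm, div_one, ENNReal.rpow_one, mul_one, Nat.cast_ofNat]
  rw [hscale]
  simp only [hscale (fun y => ‖_ - (Metric.ball c r).indicator (fun _ => (1 : ℝ)) y‖ₑ /
    ‖_ - y‖ₑ ^ (2 + s)), hind, hdist, hdiv, lintegral_const_mul' _ _ ENNReal.ofReal_ne_top]
  rw [← mul_assoc, ← mul_assoc, ← ENNReal.ofReal_mul (by positivity),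
    ← ENNReal.ofReal_mul (by positivity)]
  congr 2
  rw [← Real.rpow_neg hr.le, ← Real.rpow_natCast, ← Real.rpow_add hr, ← Real.rpow_add hr]
  congr 1
  push_cast
  ring

/-- A disc of radius `l` in `Ω` is a competitor for `h_s(Ω)`, and `P_s` scales like `l ^ (2 - s)`.
No information about `P_s(B_1)` is needed: the product on the left is at most `l ^ (-s)` even if
`P_s(B_1)` is `0` or `∞`. -/
theorem fracCheegerConstant_normalized_le_of_ball_subset {s : ℝ} (hs : 0 < s) {Ω : Set (RN 2)}
    {x : RN 2} {l : ℝ} (hl : 0 < l) (hball : Metric.ball x l ⊆ Ω) :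
    ENNReal.ofReal Real.pi / fracPerimeter s (Metric.ball (0 : RN 2) 1) * fracCheegerConstant s Ω ≤
      ENNReal.ofReal (l ^ (-s)) := by
  set P := fracPerimeter s (Metric.ball (0 : RN 2) 1) with hP
  have hvol : volume (Metric.ball x l) = ENNReal.ofReal (l ^ 2) * ENNReal.ofReal Real.pi := by
    rw [EuclideanSpace.volume_ball_fin_two, ← ENNReal.ofReal_pow hl.le]
  have hpi : ENNReal.ofReal Real.pi ≠ 0 := (ENNReal.ofReal_pos.2 Real.pi_pos).ne'
  have hh : fracCheegerConstant s Ω ≤ ENNReal.ofReal (l ^ (-s)) * (P / ENNReal.ofReal Real.pi) := by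
    refine (iInf₂_le (Metric.ball x l) ⟨hball, Metric.isBounded_ball,
      Metric.isOpen_ball.measurableSet, Metric.measure_ball_pos _ _ hl⟩).trans (le_of_eq ?_)
    rw [fracPerimeter_ball hs x hl, hvol, ← hP, div_eq_mul_inv, ENNReal.mul_inv
      (Or.inr ENNReal.ofReal_ne_top) (Or.inl ENNReal.ofReal_ne_top),
      ← ENNReal.ofReal_inv_of_pos (by positivity), mul_mul_mul_comm,
      ← ENNReal.ofReal_mul (by positivity), ← div_eq_mul_inv]
    congr 2
    rw [← Real.rpow_natCast, ← Real.rpow_sub hl]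
    congr 1
    push_cast
    ring
  calc ENNReal.ofReal Real.pi / P * fracCheegerConstant s Ω
      ≤ ENNReal.ofReal Real.pi / P *
          (ENNReal.ofReal (l ^ (-s)) * (P / ENNReal.ofReal Real.pi)) := by gcongr
    _ = ENNReal.ofReal (l ^ (-s)) * (P / P) := by
        rw [div_eq_mul_inv, div_eq_mul_inv, div_eq_mul_inv]
        calc _ = (ENNReal.ofReal Real.pi * (ENNReal.ofReal Real.pi)⁻¹) *
              (ENNReal.ofReal (l ^ (-s)) * (P * P⁻¹)) := by ring
          _ = _ := by rw [ENNReal.mul_inv_cancel hpi ENNReal.ofReal_ne_top, one_mul]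
    _ ≤ ENNReal.ofReal (l ^ (-s)) * 1 := by
        gcongr
        exact ENNReal.div_self_le_one
    _ = _ := mul_one _

/-! ### The Makai-Hayman and Cheeger inequalities -/

/-- A common lower bound for `λ₁^s(Ω)`. In the constant, `4` comes from the density
argument, `225` from averaging over discs, and `9⁴ · 40` from the annuli and the circles. -/
theorem ofReal_le_fracEigenvalue {s : ℝ} (hs : 1 / 2 < s) (hs1 : s < 1)
    {Ω : Set (RN 2)} (hΩ : IsOpen Ω) (hΩ' : IsSimplyConnected Ω) {R : ℝ} (hR : 0 < R)
    (hrad : inradius Ω = ENNReal.ofReal R) :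
    ENNReal.ofReal ((2 * s - 1) / (1 - s) / (4 * 225 * 9 ^ 4 * 40) * R ^ (-(2 * s))) ≤
      fracEigenvalue s Ω := by
  have hs' : 0 < 2 * s - 1 := by linarith
  have hs1' : 0 < 1 - s := by linarith
  have h := le_fracEigenvalue (s := s) (Ω := Ω) ENNReal.ofReal_ne_top fun φ hφ =>
    eLpNorm_sq_le_gagliardoSeminorm_sq hs hs1 hΩ hΩ' hR
      (by rw [hrad]; exact (ENNReal.ofReal_lt_ofReal_iff (by positivity)).2 (by linarith))
      hφ.1.continuous
      (fun x hx => image_eq_zero_of_notMem_tsupport fun hx' => hx (hφ.2.2 hx'))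
  refine le_trans (le_of_eq ?_) h
  rw [← ENNReal.ofReal_ofNat 4, ← ENNReal.ofReal_mul (by norm_num),
    ← ENNReal.ofReal_inv_of_pos (by positivity)]
  congr 1
  rw [Real.rpow_neg hR.le]
  field_simp

theorem exists_ball_subset_of_lt_inradius {N : ℕ} {Ω : Set (RN N)} {r : ℝ}
    (h : ENNReal.ofReal r < inradius Ω) : ∃ x, Metric.ball x r ⊆ Ω := by
  rw [inradius, lt_iSup_iff] at h
  obtain ⟨ρ, h⟩ := h
  rw [lt_iSup_iff] at h
  obtain ⟨⟨hρ, x, -, hx⟩, h⟩ := h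
  exact ⟨x, (Metric.ball_subset_ball ((ENNReal.ofReal_lt_ofReal_iff hρ).1 h).le).trans hx⟩

theorem corollary6p3 :
    ∃ C : ℝ → ℝ,
      (∀ s : ℝ, 1 / 2 < s → s < 1 → 0 < C s) ∧
      (∃ a : ℝ, 0 < a ∧ Tendsto (fun s : ℝ => C s / (s - 1 / 2)) (𝓝[>] (1 / 2 : ℝ)) (𝓝 a)) ∧
      (∃ b : ℝ, 0 < b ∧ Tendsto (fun s : ℝ => C s / (1 / (1 - s))) (𝓝[<] (1 : ℝ)) (𝓝 b)) ∧
      ∀ s : ℝ, 1 / 2 < s → s < 1 →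
        ∀ Ω : Set (RN 2), IsOpen Ω → IsSimplyConnected Ω → inradius Ω < ⊤ →
          ENNReal.ofReal (C s) / inradius Ω ^ (2 * s) ≤ fracEigenvalue s Ω ∧
          ENNReal.ofReal (C s) * (cheegerConstant Ω / 2) ^ (2 * s) ≤ fracEigenvalue s Ω ∧
          ENNReal.ofReal (C s) *
              (ENNReal.ofReal Real.pi / fracPerimeter s (Metric.ball (0 : RN 2) 1)
                * fracCheegerConstant s Ω) ^ 2 ≤ fracEigenvalue s Ω := by
  -- the factor `16` absorbs the comparison of `h₁` and `h_s` with the inradius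
  obtain ⟨A, hA⟩ : ∃ A : ℝ, A = 16 * (4 * 225 * 9 ^ 4 * 40) := ⟨_, rfl⟩
  have hA0 : 0 < A := by rw [hA]; positivity
  refine ⟨fun s => (2 * s - 1) / (1 - s) / A, fun s hs hs1 => ?_, ⟨4 / A, by positivity, ?_⟩,
    ⟨1 / A, by positivity, ?_⟩, fun s hs hs1 Ω hΩ hΩ' hfin => ?_⟩
  · have : 0 < 2 * s - 1 := by linarith
    have : 0 < 1 - s := by linarith
    positivity
  · have hlim : Tendsto (fun s : ℝ => 2 / (1 - s) / A) (𝓝[>] (1 / 2)) (𝓝 (4 / A)) := by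
      have hc : ContinuousAt (fun s : ℝ => 2 / (1 - s) / A) (1 / 2) :=
        (continuousAt_const.div (by fun_prop) (by norm_num)).div_const A
      have h4 : (2 : ℝ) / (1 - 1 / 2) / A = 4 / A := by norm_num
      rw [← h4]
      exact hc.tendsto.mono_left nhdsWithin_le_nhds
    refine hlim.congr' ?_
    filter_upwards [self_mem_nhdsWithin] with s hs
    have : s - 1 / 2 ≠ 0 := sub_ne_zero.2 (ne_of_gt hs)
    rw [show 2 * s - 1 = (s - 1 / 2) * 2 by ring, mul_div_assoc, mul_div_assoc,
      mul_div_cancel_left₀ _ this]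
  · have hlim : Tendsto (fun s : ℝ => (2 * s - 1) / A) (𝓝[<] 1) (𝓝 (1 / A)) := by
      have hc : Continuous fun s : ℝ => (2 * s - 1) / A := by fun_prop
      have h1 : (2 * 1 - 1 : ℝ) / A = 1 / A := by norm_num
      rw [← h1]
      exact (hc.tendsto 1).mono_left nhdsWithin_le_nhds
    refine hlim.congr' ?_
    filter_upwards [self_mem_nhdsWithin] with s hs
    have : 1 - s ≠ 0 := sub_ne_zero.2 (ne_of_gt hs)
    field_simp
  have hs' : 0 < 2 * s - 1 := by linarith
  have hs1' : 0 < 1 - s := by linarith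
  have hpos := inradius_pos hΩ hΩ'.nonempty
  set R : ℝ := (inradius Ω).toReal with hRdef
  have hR : 0 < R := ENNReal.toReal_pos hpos.ne' hfin.ne
  have hrad : inradius Ω = ENNReal.ofReal R := (ENNReal.ofReal_toReal hfin.ne).symm
  obtain ⟨x, hx⟩ := exists_ball_subset_of_lt_inradius (Ω := Ω) (r := R / 2)
    (by rw [hrad]; exact (ENNReal.ofReal_lt_ofReal_iff hR).2 (by linarith))
  have hmain := ofReal_le_fracEigenvalue hs hs1 hΩ hΩ' hR hrad
  set C : ℝ := (2 * s - 1) / (1 - s) / A with hC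
  have hC0 : 0 < C := by positivity
  have hCmain : (2 * s - 1) / (1 - s) / (4 * 225 * 9 ^ 4 * 40) * R ^ (-(2 * s)) =
      C * (16 * R ^ (-(2 * s))) := by
    rw [hC, hA]
    field_simp
  rw [hCmain, ENNReal.ofReal_mul hC0.le] at hmain
  refine ⟨?_, ?_, ?_⟩
  · refine le_trans ?_ hmain
    rw [hrad, ENNReal.ofReal_rpow_of_pos hR, div_eq_mul_inv,
      ← ENNReal.ofReal_inv_of_pos (by positivity), ← Real.rpow_neg hR.le]
    gcongr
    have : 0 < R ^ (-(2 * s)) := by positivity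
    linarith
  · refine le_trans ?_ hmain
    gcongr
    have h1 : cheegerConstant Ω / 2 ≤ ENNReal.ofReal (4 / R) := by
      refine ENNReal.div_le_of_le_mul ((cheegerConstant_le_of_ball_subset (half_pos hR) hx).trans
        (le_of_eq ?_))
      rw [← ENNReal.ofReal_ofNat 2, ← ENNReal.ofReal_mul (by positivity)]
      congr 1
      field_simp
    refine (ENNReal.rpow_le_rpow h1 (by linarith)).trans ?_
    rw [ENNReal.ofReal_rpow_of_pos (by positivity)]
    refine ENNReal.ofReal_le_ofReal ?_
    rw [div_eq_mul_inv, Real.mul_rpow (by norm_num) (by positivity), Real.inv_rpow hR.le,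
      ← Real.rpow_neg hR.le]
    gcongr
    calc (4 : ℝ) ^ (2 * s) ≤ 4 ^ (2 : ℝ) :=
          Real.rpow_le_rpow_of_exponent_le (by norm_num) (by linarith)
      _ = 16 := by norm_num
  · refine le_trans ?_ hmain
    gcongr
    have h1 := fracCheegerConstant_normalized_le_of_ball_subset (s := s) (by linarith)
      (half_pos hR) hx
    refine (pow_le_pow_left' h1 2).trans ?_
    rw [← ENNReal.ofReal_pow (by positivity)]
    refine ENNReal.ofReal_le_ofReal ?_
    rw [← Real.rpow_mul_natCast (by positivity), Real.div_rpow hR.le (by norm_num)]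
    have h2 : -s * ((2 : ℕ) : ℝ) = -(2 * s) := by push_cast; ring
    rw [h2, Real.rpow_neg (by norm_num : (0 : ℝ) ≤ 2), div_inv_eq_mul, mul_comm]
    gcongr
    calc (2 : ℝ) ^ (2 * s) ≤ 2 ^ (2 : ℝ) :=
          Real.rpow_le_rpow_of_exponent_le (by norm_num) (by linarith)
      _ ≤ 16 := by norm_num
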